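/- Fix an integer $n\ge 0$, write $\mathbb{T}^n=U(1)^n$ with $U(1)=\mathbb{R}/\mathbb{Z}$ (written additively), and let $X$ be a smooth manifold (finite-dimensional, without boundary, Hausdorff, second countable). **Crossed modules.** A crossed module $\Gamma=(G,H,t,\alpha)$ consists of (possibly infinite-dimensional) Lie groups $G,H$, a smooth homomorphism $t:H\to G$ and a smooth action $\alpha:G\times H\to H$ by group homomorphisms such that $t(\alpha(g,h))=g\,t(h)\,g^{-1}$ and $\alpha(t(h),h')=hh'h^{-1}$. Two crossed modules are considered: * The T-duality 2-group $\mathbb{TD}=\mathbb{TD}[n]$: $G=\mathbb{R}^{2n}$, $H=\mathbb{Z}^{2n}\times U(1)$, $t(z,s)=z$ and $\alpha(x,(z,s))=(z,s-[x,z])$, where $[a\oplus\hat a,\,a'\oplus\hat a']=\hat a\cdot a'$ for $a,\hat a,a',\hat a'\in\mathbb{R}^n$ (the categorical torus of this bilinear form). * The 2-group $\mathbb{TB}_{F2}^{R}=\mathbb{TB}_{F2}^{R}[n]$: $G=\mathbb{R}^n$, $H=C^\infty(\mathbb{T}^n,U(1))\times\mathbb{Z}^n$ with the Fréchet Lie group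 structure on $C^\infty(\mathbb{T}^n,U(1))$, $t(\tau,m)=m$ and $\alpha(a,(\tau,m))=(\tau(\cdot-a),m)$. **Non-abelian cohomology.** A $\Gamma$-cocycle with respect to an open cover $\{U_i\}$ of $X$ consists of smooth maps $g_{ij}:U_i\cap U_j\to G$ and $a_{ijk}:U_i\cap U_j\cap U_k\to H$ with $g_{ii}=1$, $a_{iij}=a_{ijj}=1$, $$t(a_{ijk})\,g_{jk}\,g_{ij}=g_{ik},\qquad a_{ikl}\,\alpha(g_{kl},a_{ijk})=a_{ijl}\,a_{jkl}.$$ Two cocycles $(g,a)$, $(g',a')$ with respect to the same cover are equivalent if there are smooth maps $h_i:U_i\to G$ and $e_{ij}:U_i\cap U_j\to H$ with $e_{ii}=1$, $$t(e_{ij})\,h_j\,g_{ij}=g'_{ij}\,h_i,\qquad a'_{ijk}\,\alpha(g'_{jk},e_{ij})\,e_{jk}=e_{ik}\,\alpha(h_k,a_{ijk});$$ cocycles with respect to arbitrary covers are equivalent if their restrictions to some common refinement are. The set of equivalence classes is denoted $H^1(X,\Gamma)$. **The left leg projection.** A crossed intertwiner $(\phi,f,\eta):(G,H,t,\alpha)\to(G',H',t',\alpha')$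 consists of smooth homomorphisms $\phi:G\to G'$, $f:H\to H'$ and a smooth map $\eta:G\times G\to\ker t'$ satisfying $\phi(t(h))=t'(f(h))$, $\eta(t(h),t(h'))=1$, $$\eta(g,t(h)g^{-1})\,f(\alpha(g,h))=\alpha'(\phi(g),\eta(t(h)g^{-1},g)\,f(h)),$$ $$\eta(g,g')\,\eta(gg',g'')=\alpha'(\phi(g),\eta(g',g''))\,\eta(g,g'g'').$$ It induces a well-defined map $H^1(X,\Gamma)\to H^1(X,\Gamma')$, sending the class of $(g,a)$ to the class of $(g',a')$ with $g'_{ij}=\phi(g_{ij})$ and $$a'_{ijk}=\eta(t(a_{ijk}),g_{jk}g_{ij})^{-1}\,f(a_{ijk})\,\eta(g_{jk},g_{ij})^{-1}.$$ The left leg projection is the crossed intertwiner $\mathrm{leleR}=(\phi,f,\eta):\mathbb{TD}\to\mathbb{TB}_{F2}^{R}$ given by $$\phi(a\oplus\hat a)=a,\qquad f(m\oplus\hat m,s)=\big(c\mapsto s+\hat m\cdot c,\;m\big),\qquad \eta(a\oplus\hat a,a'\oplus\hat a')=\big(c\mapsto\hat a\cdot a',\;0\big).$$ **Theorem.** The induced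 map $$\mathrm{leleR}_*:H^1(X,\mathbb{TD})\longrightarrow H^1(X,\mathbb{TB}_{F2}^{R})$$ is a bijection. -/

import Mathlib

open scoped Manifold ContDiff
open Set TopologicalSpace

set_option linter.unusedVariables false
set_option linter.checkUnivs false

namespace TDuality

/-! ### Smooth maps from manifolds into (possibly infinite-dimensional) spaces -/

/-- A smooth structure on a set `S`, given by its sheaf of smooth `S`-valued maps: for every open
subset `U` of a smooth manifold `X` it is specified which maps (given as functions on `X`, only
the values on `U` matter) are smooth maps `U → S`. Constant maps are smooth, and smoothness is
stable under precomposition with smooth maps and local. Finite-dimensional manifolds and the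
Fréchet manifold `C^∞(𝕋ⁿ, U(1))` are regarded in this way; it is all that enters into smooth
cocycles. -/
class SmoothSpace.{u, v} (S : Type v) where
  SmoothOn (d : ℕ) {X : Type u} [TopologicalSpace X] [ChartedSpace (EuclideanSpace ℝ (Fin d)) X]
    [IsManifold (𝓡 d) ∞ X] (f : X → S) (U : Opens X) : Prop
  smoothOn_const (d : ℕ) {X : Type u} [TopologicalSpace X]
    [ChartedSpace (EuclideanSpace ℝ (Fin d)) X] [IsManifold (𝓡 d) ∞ X] (s : S) (U : Opens X) :
    SmoothOn d (fun _ : X => s) U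
  smoothOn_comp (d d' : ℕ) {X Y : Type u} [TopologicalSpace X]
    [ChartedSpace (EuclideanSpace ℝ (Fin d)) X] [IsManifold (𝓡 d) ∞ X] [TopologicalSpace Y]
    [ChartedSpace (EuclideanSpace ℝ (Fin d')) Y] [IsManifold (𝓡 d') ∞ Y] (f : X → S) (U : Opens X)
    (p : Y → X) (V : Opens Y) (hp : ContMDiffOn (𝓡 d') (𝓡 d) ∞ p V) (hpVU : MapsTo p V U)
    (hf : SmoothOn d f U) : SmoothOn d' (f ∘ p) V
  smoothOn_of_locally (d : ℕ) {X : Type u} [TopologicalSpace X]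
    [ChartedSpace (EuclideanSpace ℝ (Fin d)) X] [IsManifold (𝓡 d) ∞ X] (f : X → S) (U : Opens X)
    (h : ∀ x ∈ U, ∃ W : Opens X, x ∈ W ∧ SmoothOn d f (U ⊓ W)) : SmoothOn d f U
  smoothOn_congr (d : ℕ) {X : Type u} [TopologicalSpace X]
    [ChartedSpace (EuclideanSpace ℝ (Fin d)) X] [IsManifold (𝓡 d) ∞ X] (f g : X → S) (U : Opens X)
    (h : ∀ x ∈ U, f x = g x) (hf : SmoothOn d f U) : SmoothOn d g U

open SmoothSpace

theorem SmoothSpace.SmoothOn.mono {S : Type*} [SmoothSpace S] {d : ℕ} {X : Type*}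
    [TopologicalSpace X] [ChartedSpace (EuclideanSpace ℝ (Fin d)) X] [IsManifold (𝓡 d) ∞ X]
    {f : X → S} {U V : Opens X} (hf : SmoothOn d f U) (h : V ≤ U) : SmoothOn d f V :=
  smoothOn_comp d d f U id V contMDiffOn_id h hf

/-- A map between smooth spaces is smooth if it takes smooth maps to smooth maps. -/
def IsSmoothMap.{u, v, w} {S : Type v} {T : Type w} [SmoothSpace.{u} S] [SmoothSpace.{u} T]
    (F : S → T) : Prop :=
  ∀ (d : ℕ) (X : Type u) [TopologicalSpace X] [ChartedSpace (EuclideanSpace ℝ (Fin d)) X]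
    [IsManifold (𝓡 d) ∞ X] (f : X → S) (U : Opens X),
    SmoothOn d f U → SmoothOn d (fun x => F (f x)) U

/-- The product smooth structure. -/
instance SmoothSpace.instProd.{u, v, w} {S : Type v} {T : Type w} [SmoothSpace.{u} S]
    [SmoothSpace.{u} T] : SmoothSpace.{u} (S × T) where
  SmoothOn d X _ _ _ f U := SmoothOn d (fun x => (f x).1) U ∧ SmoothOn d (fun x => (f x).2) U
  smoothOn_const d X _ _ _ s U := ⟨smoothOn_const d _ U, smoothOn_const d _ U⟩
  smoothOn_comp d d' X Y _ _ _ _ _ _ f U p V hp hpVU hf :=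
    ⟨smoothOn_comp d d' _ U p V hp hpVU hf.1, smoothOn_comp d d' _ U p V hp hpVU hf.2⟩
  smoothOn_of_locally d X _ _ _ f U h :=
    ⟨smoothOn_of_locally d _ U fun x hx => let ⟨W, hW, h'⟩ := h x hx; ⟨W, hW, h'.1⟩,
      smoothOn_of_locally d _ U fun x hx => let ⟨W, hW, h'⟩ := h x hx; ⟨W, hW, h'.2⟩⟩
  smoothOn_congr d X _ _ _ f g U h hf :=
    ⟨smoothOn_congr d _ _ U (fun x hx => congrArg Prod.fst (h x hx)) hf.1,
      smoothOn_congr d _ _ U (fun x hx => congrArg Prod.snd (h x hx)) hf.2⟩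

instance SmoothSpace.instMultiplicative.{u, v} {S : Type v} [h : SmoothSpace.{u} S] :
    SmoothSpace.{u} (Multiplicative S) := h

/-- The standard smooth structure on a finite-dimensional manifold. -/
@[reducible]
def SmoothSpace.ofManifold.{u, v, w, w'} {E : Type w} [NormedAddCommGroup E] [NormedSpace ℝ E]
    {H : Type w'} [TopologicalSpace H] (I : ModelWithCorners ℝ E H) (S : Type v)
    [TopologicalSpace S] [ChartedSpace H S] : SmoothSpace.{u} S where
  SmoothOn d X _ _ _ f U := ContMDiffOn (𝓡 d) I ∞ f (U : Set X)
  smoothOn_const d X _ _ _ s U := contMDiffOn_const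
  smoothOn_comp d d' X Y _ _ _ _ _ _ f U p V hp hpVU hf := hf.comp hp hpVU
  smoothOn_of_locally d X _ _ _ f U h := contMDiffOn_of_locally_contMDiffOn fun x hx =>
    let ⟨W, hW, h'⟩ := h x hx; ⟨W, W.isOpen, hW, h'⟩
  smoothOn_congr d X _ _ _ f g U h hf := hf.congr fun x hx => (h x hx).symm

/-- The smooth structure of a discrete set: smooth maps are the locally constant ones. -/
@[reducible]
def SmoothSpace.discrete.{u, v} (S : Type v) : SmoothSpace.{u} S where
  SmoothOn d X _ _ _ f U := ∀ x ∈ U, ∀ᶠ y in nhds x, f y = f x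
  smoothOn_const d X _ _ _ s U := by simp
  smoothOn_comp d d' X Y _ _ _ _ _ _ f U p V hp hpVU hf := fun y hy =>
    ((hp.continuousOn.continuousAt (V.isOpen.mem_nhds hy)).eventually (hf _ (hpVU hy)))
  smoothOn_of_locally d X _ _ _ f U h := fun x hx =>
    let ⟨W, hW, h'⟩ := h x hx; h' x ⟨hx, hW⟩
  smoothOn_congr d X _ _ _ f g U h hf := fun x hx => by
    filter_upwards [hf x hx, U.isOpen.mem_nhds hx] with y hy hyU
    rw [← h x hx, ← h y hyU, hy]

/-! ### Lie groups, crossed modules and crossed intertwiners -/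

/-- A group object in smooth spaces: multiplication and inversion are smooth. -/
class SmoothGroup.{u, v} (G : Type v) [Group G] extends SmoothSpace.{u} G where
  smooth_mul : IsSmoothMap.{u} fun p : G × G => p.1 * p.2
  smooth_inv : IsSmoothMap.{u} fun g : G => g⁻¹

/-- A crossed module `(G, H, t, α)` of (possibly infinite-dimensional) Lie groups,
i.e. a strict Lie 2-group. -/
structure CrossedModule.{u, v, w} where
  G : Type v
  H : Type w
  [groupG : Group G]
  [groupH : Group H]
  [smoothG : SmoothGroup.{u} G]
  [smoothH : SmoothGroup.{u} H]
  t : H →* G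
  α : G →* MulAut H
  smooth_t : IsSmoothMap.{u} fun h : H => t h
  smooth_α : IsSmoothMap.{u} fun p : G × H => α p.1 p.2
  α_t : ∀ h h' : H, α (t h) h' = h * h' * h⁻¹
  t_α : ∀ (g : G) (h : H), t (α g h) = g * t h * g⁻¹

attribute [instance] CrossedModule.groupG CrossedModule.groupH CrossedModule.smoothG
  CrossedModule.smoothH

/-- A crossed intertwiner `(φ, f, η)` between crossed modules; `η` takes values in
`U' = ker t'`. -/
structure CrossedIntertwiner.{u, v, w, v', w'} (Γ : CrossedModule.{u, v, w})
    (Γ' : CrossedModule.{u, v', w'}) where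
  φ : Γ.G →* Γ'.G
  f : Γ.H →* Γ'.H
  η : Γ.G → Γ.G → Γ'.H
  smooth_φ : IsSmoothMap.{u} fun g : Γ.G => φ g
  smooth_f : IsSmoothMap.{u} fun h : Γ.H => f h
  smooth_η : IsSmoothMap.{u} fun p : Γ.G × Γ.G => η p.1 p.2
  t_η : ∀ g g', Γ'.t (η g g') = 1
  φ_t : ∀ h, φ (Γ.t h) = Γ'.t (f h)
  η_t : ∀ h h', η (Γ.t h) (Γ.t h') = 1
  η_f : ∀ g h, η g (Γ.t h * g⁻¹) * f (Γ.α g h) =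
    Γ'.α (φ g) (η (Γ.t h * g⁻¹) g) * Γ'.α (φ g) (f h)
  η_cocycle : ∀ g g' g'', η g g' * η (g * g') g'' = Γ'.α (φ g) (η g' g'') * η g (g' * g'')

namespace CrossedModule

variable {Γ : CrossedModule}

/-- Elements of `ker t` are central. -/
theorem commute_of_t_eq_one {u : Γ.H} (hu : Γ.t u = 1) (h : Γ.H) : u * h = h * u := by
  have := Γ.α_t u h
  rw [hu, map_one, MulAut.one_apply] at this
  rw [eq_mul_inv_iff_mul_eq] at this
  exact this.symm

theorem α_mul (g g' : Γ.G) (h : Γ.H) : Γ.α (g * g') h = Γ.α g (Γ.α g' h) := by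
  rw [map_mul]; rfl

theorem α_t_mul (h : Γ.H) (g : Γ.G) (h' : Γ.H) :
    Γ.α (Γ.t h * g) h' = h * Γ.α g h' * h⁻¹ := by
  rw [α_mul, α_t]

end CrossedModule

namespace CrossedIntertwiner

variable {Γ Γ' : CrossedModule} (F : CrossedIntertwiner Γ Γ')

theorem t_α_η (k : Γ'.G) (g g' : Γ.G) : Γ'.t (Γ'.α k (F.η g g')) = 1 := by
  rw [Γ'.t_α, F.t_η]; simp

theorem η_comm (g g' : Γ.G) (h : Γ'.H) : F.η g g' * h = h * F.η g g' :=
  Γ'.commute_of_t_eq_one (F.t_η g g') h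

theorem α_η_comm (k : Γ'.G) (g g' : Γ.G) (h : Γ'.H) :
    Γ'.α k (F.η g g') * h = h * Γ'.α k (F.η g g') :=
  Γ'.commute_of_t_eq_one (F.t_α_η k g g') h

theorem α_φ_t_η (h : Γ.H) (g g' : Γ.G) : Γ'.α (F.φ (Γ.t h)) (F.η g g') = F.η g g' := by
  rw [F.φ_t, Γ'.α_t, ← F.η_comm, mul_inv_cancel_right]

theorem η_one_left (g : Γ.G) : F.η 1 g = 1 := by
  have h1 : F.η 1 1 = 1 := by simpa using F.η_t 1 1
  have := F.η_cocycle 1 1 g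
  simpa [h1] using this

theorem η_one_right (g : Γ.G) : F.η g 1 = 1 := by
  have h1 : F.η 1 1 = 1 := by simpa using F.η_t 1 1
  have := F.η_cocycle g 1 1
  simpa [h1] using this

/-- The `H'`-component `η(t(h), g)⁻¹ f(h)` of the image of the morphism `(h, g)` of the Lie
2-group of `Γ` under the functor associated to `F`. -/
def mor (h : Γ.H) (g : Γ.G) : Γ'.H := (F.η (Γ.t h) g)⁻¹ * F.f h

theorem mor_one (g : Γ.G) : F.mor 1 g = 1 := by
  simp [mor, η_one_left]

theorem t_mor (h : Γ.H) (g : Γ.G) : Γ'.t (F.mor h g) = F.φ (Γ.t h) := by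
  simp [mor, F.t_η, F.φ_t]

/-- Functoriality. -/
theorem mor_mul (h' h : Γ.H) (g : Γ.G) :
    F.mor (h' * h) g = F.mor h' (Γ.t h * g) * F.mor h g := by
  have h1 := F.η_cocycle (Γ.t h') (Γ.t h) g
  rw [F.η_t, one_mul, F.φ_t, Γ'.α_t, ← map_mul] at h1
  have h2 : F.f h' * F.η (Γ.t h) g * (F.f h')⁻¹ = F.η (Γ.t h) g := by
    rw [← F.η_comm, mul_inv_cancel_right]
  rw [h2] at h1
  simp only [mor]
  rw [h1, mul_inv_rev, map_mul, mul_assoc, mul_assoc]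
  congr 1
  rw [← mul_assoc, ← mul_assoc]
  congr 1
  rw [inv_mul_eq_iff_eq_mul, ← mul_assoc, F.η_comm, mul_inv_cancel_right]

/-- Naturality of the multiplicator in the first variable. -/
theorem η_mul_mor_left (h : Γ.H) (g g' : Γ.G) :
    F.η (Γ.t h * g) g' * F.mor h (g * g') = F.mor h g * F.η g g' := by
  have h1 := F.η_cocycle (Γ.t h) g g'
  rw [F.α_φ_t_η] at h1
  simp only [mor]
  rw [mul_assoc (F.η (Γ.t h) g)⁻¹, ← F.η_comm, ← mul_assoc, ← mul_assoc]
  congr 1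
  rw [eq_inv_mul_iff_mul_eq, ← mul_assoc, h1, mul_inv_cancel_right]

/-- Naturality of the multiplicator in the second variable. -/
theorem η_mul_mor_right (h : Γ.H) (g g' : Γ.G) :
    F.η g (Γ.t h * g') * F.mor (Γ.α g h) (g * g') =
      Γ'.α (F.φ g) (F.mor h g') * F.η g g' := by
  have h1 := congrArg (Γ'.α (F.φ g)) (F.η_cocycle (Γ.t h * g⁻¹) g g')
  rw [map_mul (Γ'.α (F.φ g)), map_mul (Γ'.α (F.φ g)), ← Γ'.α_mul, ← map_mul F.φ,
    ← mul_assoc g, ← Γ.t_α, F.α_φ_t_η, inv_mul_cancel_right] at h1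
  have h2 := F.η_cocycle g (Γ.t h * g⁻¹) (g * g')
  rw [← mul_assoc g, ← Γ.t_α, show Γ.t h * g⁻¹ * (g * g') = Γ.t h * g' by group] at h2
  have h3 := F.η_f g h
  have h4 : F.f (Γ.α g h) = (F.η g (Γ.t h * g⁻¹))⁻¹ *
      (Γ'.α (F.φ g) (F.η (Γ.t h * g⁻¹) g) * Γ'.α (F.φ g) (F.f h)) := by
    rw [← h3, inv_mul_cancel_left]
  have h5 : F.η g (Γ.t h * g') * (F.η (Γ.t (Γ.α g h)) (g * g'))⁻¹ *
      (F.η g (Γ.t h * g⁻¹))⁻¹ = (Γ'.α (F.φ g) (F.η (Γ.t h * g⁻¹) (g * g')))⁻¹ := by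
    rw [mul_assoc, ← mul_inv_rev, h2, mul_inv_rev, mul_inv_cancel_left]
  have h6 : Γ'.α (F.φ g) (F.η (Γ.t h * g⁻¹) g) = F.η g g' *
      Γ'.α (F.φ g) (F.η (Γ.t h * g⁻¹) (g * g')) * (Γ'.α (F.φ g) (F.η (Γ.t h) g'))⁻¹ := by
    rw [← h1, mul_inv_cancel_right]
  simp only [mor]
  rw [map_mul, map_inv, h4, ← mul_assoc, ← mul_assoc, h5, ← mul_assoc, h6, F.η_comm]
  rw [← mul_assoc, ← mul_assoc, inv_mul_cancel, one_mul, mul_assoc, mul_assoc, F.η_comm,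
    mul_assoc]

theorem mor_eq (h : Γ.H) (g g' : Γ.G) :
    F.mor h g = F.η (Γ.t h * g) g' * F.mor h (g * g') * (F.η g g')⁻¹ := by
  rw [η_mul_mor_left, mul_inv_cancel_right]

theorem α_mor (h : Γ.H) (g g' : Γ.G) :
    Γ'.α (F.φ g) (F.mor h g') =
      F.η g (Γ.t h * g') * F.mor (Γ.α g h) (g * g') * (F.η g g')⁻¹ := by
  rw [η_mul_mor_right, mul_inv_cancel_right]

end CrossedIntertwiner
/-! ### Non-abelian cohomology -/

section Cohomology

universe u v w v' w'

variable {d : ℕ} {X : Type u} [TopologicalSpace X] [ChartedSpace (EuclideanSpace ℝ (Fin d)) X]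
  [IsManifold (𝓡 d) ∞ X]

/-- An open cover `{U_i}` of `X`. -/
structure OpenCover (X : Type u) [TopologicalSpace X] where
  ι : Type u
  U : ι → Opens X
  exists_mem : ∀ x, ∃ i, x ∈ U i

/-- `𝒱` is a refinement of `𝒰`, together with the choice of a refinement map. -/
structure Refinement {X : Type u} [TopologicalSpace X] (𝒱 𝒰 : OpenCover X) where
  map : 𝒱.ι → 𝒰.ι
  le : ∀ j, 𝒱.U j ≤ 𝒰.U (map j)

/-- The composition of refinements. -/
def Refinement.comp {X : Type u} [TopologicalSpace X] {𝒰 𝒱 𝒲 : OpenCover X}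
    (r : Refinement 𝒱 𝒰) (s : Refinement 𝒲 𝒱) : Refinement 𝒲 𝒰 where
  map k := r.map (s.map k)
  le k := (s.le k).trans (r.le _)

variable (d)

/-- A `Γ`-cocycle with respect to an open cover: smooth maps `g i j : U_i ∩ U_j → G` and
`a i j k : U_i ∩ U_j ∩ U_k → H` subject to the cocycle conditions. The maps are given by functions
on all of `X`, whose values outside of the respective intersections are irrelevant. -/
structure Cocycle (Γ : CrossedModule.{u, v, w}) (𝒰 : OpenCover X) where
  g : 𝒰.ι → 𝒰.ι → X → Γ.G
  a : 𝒰.ι → 𝒰.ι → 𝒰.ι → X → Γ.H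
  smooth_g : ∀ i j, SmoothOn d (g i j) (𝒰.U i ⊓ 𝒰.U j)
  smooth_a : ∀ i j k, SmoothOn d (a i j k) (𝒰.U i ⊓ 𝒰.U j ⊓ 𝒰.U k)
  g_self : ∀ i, ∀ x ∈ 𝒰.U i, g i i x = 1
  a_left : ∀ i j, ∀ x ∈ 𝒰.U i ⊓ 𝒰.U j, a i i j x = 1
  a_right : ∀ i j, ∀ x ∈ 𝒰.U i ⊓ 𝒰.U j, a i j j x = 1
  t_a : ∀ i j k, ∀ x ∈ 𝒰.U i ⊓ 𝒰.U j ⊓ 𝒰.U k,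
    Γ.t (a i j k x) * g j k x * g i j x = g i k x
  cocycle : ∀ i j k l, ∀ x ∈ 𝒰.U i ⊓ 𝒰.U j ⊓ 𝒰.U k ⊓ 𝒰.U l,
    a i k l x * Γ.α (g k l x) (a i j k x) = a i j l x * a j k l x

variable {d}

namespace Cocycle

variable {Γ : CrossedModule.{u, v, w}} {𝒰 𝒱 𝒲 : OpenCover X}

/-- The restriction of a cocycle to a refinement. -/
def restrict (c : Cocycle d Γ 𝒰) (r : Refinement 𝒱 𝒰) : Cocycle d Γ 𝒱 where
  g i j := c.g (r.map i) (r.map j)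
  a i j k := c.a (r.map i) (r.map j) (r.map k)
  smooth_g i j := (c.smooth_g _ _).mono (inf_le_inf (r.le i) (r.le j))
  smooth_a i j k := (c.smooth_a _ _ _).mono (inf_le_inf (inf_le_inf (r.le i) (r.le j)) (r.le k))
  g_self i x hx := c.g_self _ x (r.le i hx)
  a_left i j x hx := c.a_left _ _ x (inf_le_inf (r.le i) (r.le j) hx)
  a_right i j x hx := c.a_right _ _ x (inf_le_inf (r.le i) (r.le j) hx)
  t_a i j k x hx := c.t_a _ _ _ x (inf_le_inf (inf_le_inf (r.le i) (r.le j)) (r.le k) hx)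
  cocycle i j k l x hx := c.cocycle _ _ _ _ x
    (inf_le_inf (inf_le_inf (inf_le_inf (r.le i) (r.le j)) (r.le k)) (r.le l) hx)

/-- Equivalence `(g, a) ∼ (g', a')` of cocycles with respect to the same open cover. -/
def Equivalent (c c' : Cocycle d Γ 𝒰) : Prop :=
  ∃ (h : 𝒰.ι → X → Γ.G) (e : 𝒰.ι → 𝒰.ι → X → Γ.H),
    (∀ i, SmoothOn d (h i) (𝒰.U i)) ∧
    (∀ i j, SmoothOn d (e i j) (𝒰.U i ⊓ 𝒰.U j)) ∧
    (∀ i, ∀ x ∈ 𝒰.U i, e i i x = 1) ∧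
    (∀ i j, ∀ x ∈ 𝒰.U i ⊓ 𝒰.U j, Γ.t (e i j x) * h j x * c.g i j x = c'.g i j x * h i x) ∧
    (∀ i j k, ∀ x ∈ 𝒰.U i ⊓ 𝒰.U j ⊓ 𝒰.U k,
      c'.a i j k x * Γ.α (c'.g j k x) (e i j x) * e j k x =
        e i k x * Γ.α (h k x) (c.a i j k x))

theorem Equivalent.restrict {c c' : Cocycle d Γ 𝒰} (H : Equivalent c c') (r : Refinement 𝒱 𝒰) :
    Equivalent (c.restrict r) (c'.restrict r) := by
  obtain ⟨h, e, h1, h2, h3, h4, h5⟩ := H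
  exact ⟨fun i => h (r.map i), fun i j => e (r.map i) (r.map j),
    fun i => (h1 _).mono (r.le i), fun i j => (h2 _ _).mono (inf_le_inf (r.le i) (r.le j)),
    fun i x hx => h3 _ x (r.le i hx), fun i j x hx => h4 _ _ x (inf_le_inf (r.le i) (r.le j) hx),
    fun i j k x hx => h5 _ _ _ x (inf_le_inf (inf_le_inf (r.le i) (r.le j)) (r.le k) hx)⟩

end Cocycle

section Smooth

variable {G : Type*} [Group G] [SmoothGroup.{u} G] {U : Opens X}

theorem smoothOn_mul {f g : X → G} (hf : SmoothOn d f U) (hg : SmoothOn d g U) :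
    SmoothOn d (fun x => f x * g x) U :=
  SmoothGroup.smooth_mul d X (fun x => (f x, g x)) U ⟨hf, hg⟩

theorem smoothOn_inv {f : X → G} (hf : SmoothOn d f U) : SmoothOn d (fun x => (f x)⁻¹) U :=
  SmoothGroup.smooth_inv d X f U hf

theorem CrossedModule.smoothOn_α {Γ : CrossedModule.{u, v, w}} {g : X → Γ.G} {h : X → Γ.H}
    (hg : SmoothOn d g U) (hh : SmoothOn d h U) : SmoothOn d (fun x => Γ.α (g x) (h x)) U :=
  Γ.smooth_α d X (fun x => (g x, h x)) U ⟨hg, hh⟩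

end Smooth

namespace Cocycle

variable {Γ : CrossedModule.{u, v, w}} {𝒰 𝒱 𝒲 : OpenCover X}

theorem Equivalent.symm {c c' : Cocycle d Γ 𝒰} (H : Equivalent c c') : Equivalent c' c := by
  obtain ⟨h, e, h1, h2, h3, h4, h5⟩ := H
  refine ⟨fun i x => (h i x)⁻¹, fun i j x => (Γ.α (h j x)⁻¹ (e i j x))⁻¹,
    fun i => smoothOn_inv (h1 i),
    fun i j => smoothOn_inv (CrossedModule.smoothOn_α (smoothOn_inv ((h1 j).mono inf_le_right))
      (h2 i j)), fun i x hx => by simp [h3 i x hx], fun i j x hx => ?_, fun i j k x hx => ?_⟩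
  · have := h4 i j x hx
    rw [map_inv, Γ.t_α, eq_mul_inv_of_mul_eq this.symm]
    group
  · have e4 := h4 j k x ⟨hx.1.2, hx.2⟩
    have e5 := h5 i j k x hx
    have key : Γ.α (h k x) (Γ.α (c.g j k x) (Γ.α (h j x)⁻¹ (e i j x))) =
        (e j k x)⁻¹ * Γ.α (c'.g j k x) (e i j x) * e j k x := by
      rw [← Γ.α_mul, ← Γ.α_mul]
      have : h k x * c.g j k x * (h j x)⁻¹ = Γ.t (e j k x)⁻¹ * c'.g j k x := by
        rw [eq_comm, map_inv, inv_mul_eq_iff_eq_mul, ← mul_assoc, ← mul_assoc,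
          eq_mul_inv_iff_mul_eq, ← e4]
      rw [this, Γ.α_t_mul, inv_inv]
    apply (Γ.α (h k x)).injective
    simp only [map_mul, map_inv] at key ⊢
    rw [key]
    simp only [MulAut.apply_inv_self]
    rw [eq_inv_mul_iff_mul_eq]
    simp only [← mul_assoc]
    rw [← e5]
    group

theorem Equivalent.trans {c c' c'' : Cocycle d Γ 𝒰} (H : Equivalent c c')
    (H' : Equivalent c' c'') : Equivalent c c'' := by
  obtain ⟨h, e, h1, h2, h3, h4, h5⟩ := H
  obtain ⟨h', e', h1', h2', h3', h4', h5'⟩ := H'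
  refine ⟨fun i x => h' i x * h i x, fun i j x => e' i j x * Γ.α (h' j x) (e i j x),
    fun i => smoothOn_mul (h1' i) (h1 i),
    fun i j => smoothOn_mul (h2' i j) (CrossedModule.smoothOn_α ((h1' j).mono inf_le_right)
      (h2 i j)), fun i x hx => by simp [h3 i x hx, h3' i x hx], fun i j x hx => ?_,
      fun i j k x hx => ?_⟩
  · have e4 := h4 i j x hx
    have e4' := h4' i j x hx
    rw [map_mul, Γ.t_α, ← mul_assoc (c''.g i j x), ← e4', mul_assoc _ _ (h i x), ← e4]
    group
  · have e4' := h4' j k x ⟨hx.1.2, hx.2⟩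
    have e5 := h5 i j k x hx
    have e5' := h5' i j k x hx
    have key : Γ.α (c''.g j k x) (Γ.α (h' j x) (e i j x)) * e' j k x =
        e' j k x * Γ.α (h' k x) (Γ.α (c'.g j k x) (e i j x)) := by
      rw [← Γ.α_mul, ← Γ.α_mul, ← e4', mul_assoc, Γ.α_t_mul]
      group
    calc c''.a i j k x * Γ.α (c''.g j k x) (e' i j x * Γ.α (h' j x) (e i j x)) *
          (e' j k x * Γ.α (h' k x) (e j k x))
        = c''.a i j k x * Γ.α (c''.g j k x) (e' i j x) *
          (Γ.α (c''.g j k x) (Γ.α (h' j x) (e i j x)) * e' j k x) * Γ.α (h' k x) (e j k x) := by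
          simp only [map_mul (Γ.α (c''.g j k x)), mul_assoc]
      _ = (c''.a i j k x * Γ.α (c''.g j k x) (e' i j x) * e' j k x) *
          Γ.α (h' k x) (Γ.α (c'.g j k x) (e i j x)) * Γ.α (h' k x) (e j k x) := by
          rw [key]; simp only [mul_assoc]
      _ = e' i k x * Γ.α (h' k x) (c'.a i j k x * Γ.α (c'.g j k x) (e i j x) * e j k x) := by
          rw [e5']; simp only [map_mul (Γ.α (h' k x)), mul_assoc]
      _ = _ := by
          rw [e5, map_mul (Γ.α (h' k x)), ← Γ.α_mul]; simp only [mul_assoc]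

/-- Restrictions along two different refinement maps are equivalent. -/
theorem equivalent_restrict (c : Cocycle d Γ 𝒰) (r s : Refinement 𝒱 𝒰) :
    Equivalent (c.restrict r) (c.restrict s) := by
  refine ⟨fun j => c.g (r.map j) (s.map j), fun i j x =>
    (c.a (r.map i) (s.map i) (s.map j) x)⁻¹ * c.a (r.map i) (r.map j) (s.map j) x,
    fun j => (c.smooth_g _ _).mono (le_inf (r.le j) (s.le j)), fun i j => smoothOn_mul
      (smoothOn_inv ((c.smooth_a _ _ _).mono ?_)) ((c.smooth_a _ _ _).mono ?_), fun i x hx => ?_,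
      fun i j x hx => ?_, fun i j k x hx => ?_⟩
  · exact fun x hx => ⟨⟨r.le i hx.1, s.le i hx.1⟩, s.le j hx.2⟩
  · exact fun x hx => ⟨⟨r.le i hx.1, r.le j hx.2⟩, s.le j hx.2⟩
  · beta_reduce
    rw [c.a_left _ _ x ⟨r.le i hx, s.le i hx⟩, c.a_right _ _ x ⟨r.le i hx, s.le i hx⟩]
    simp
  · have e1 := c.t_a (r.map i) (s.map i) (s.map j) x ⟨⟨r.le i hx.1, s.le i hx.1⟩, s.le j hx.2⟩
    have e2 := c.t_a (r.map i) (r.map j) (s.map j) x ⟨⟨r.le i hx.1, r.le j hx.2⟩, s.le j hx.2⟩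
    simp only [restrict, map_mul, map_inv]
    rw [mul_assoc, mul_assoc, inv_mul_eq_iff_eq_mul, ← mul_assoc, ← mul_assoc, e1, e2]
  · have ri := r.le i hx.1.1
    have rj := r.le j hx.1.2
    have rk := r.le k hx.2
    have si := s.le i hx.1.1
    have sj := s.le j hx.1.2
    have sk := s.le k hx.2
    have e1 := c.cocycle (r.map i) (r.map j) (r.map k) (s.map k) x ⟨⟨⟨ri, rj⟩, rk⟩, sk⟩
    have e2 := c.cocycle (r.map i) (s.map i) (s.map j) (s.map k) x ⟨⟨⟨ri, si⟩, sj⟩, sk⟩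
    have e3 := c.cocycle (r.map i) (r.map j) (s.map j) (s.map k) x ⟨⟨⟨ri, rj⟩, sj⟩, sk⟩
    simp only [restrict]
    rw [map_mul, map_inv, mul_assoc _ (c.a (r.map i) (r.map k) (s.map k) x), e1,
      eq_inv_mul_iff_mul_eq]
    simp only [← mul_assoc]
    rw [← e2, mul_inv_cancel_right, e3, mul_inv_cancel_right]

end Cocycle

/-- The common refinement `{U_i ∩ V_j}` of two open covers. -/
def OpenCover.inf {X : Type u} [TopologicalSpace X] (𝒰 𝒱 : OpenCover X) : OpenCover X where
  ι := 𝒰.ι × 𝒱.ι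
  U p := 𝒰.U p.1 ⊓ 𝒱.U p.2
  exists_mem x :=
    let ⟨i, hi⟩ := 𝒰.exists_mem x
    let ⟨j, hj⟩ := 𝒱.exists_mem x
    ⟨(i, j), hi, hj⟩

variable (d X) in
/-- Cocycles with respect to arbitrary open covers are equivalent if they become equivalent on a
common refinement. -/
def cocycleSetoid (Γ : CrossedModule.{u, v, w}) : Setoid (Σ 𝒰 : OpenCover X, Cocycle d Γ 𝒰) where
  r c c' := ∃ (𝒱 : OpenCover X) (r : Refinement 𝒱 c.1) (r' : Refinement 𝒱 c'.1),
    (c.2.restrict r).Equivalent (c'.2.restrict r')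
  iseqv :=
    { refl := fun c => ⟨c.1, ⟨id, fun _ => le_rfl⟩, ⟨id, fun _ => le_rfl⟩,
        Cocycle.equivalent_restrict _ _ _⟩
      symm := fun ⟨𝒱, r, r', H⟩ => ⟨𝒱, r', r, H.symm⟩
      trans := by
        rintro c c' c'' ⟨𝒱, r, r', H⟩ ⟨𝒲, s, s', K⟩
        let p : Refinement (𝒱.inf 𝒲) 𝒱 := ⟨Prod.fst, fun _ => inf_le_left⟩
        let q : Refinement (𝒱.inf 𝒲) 𝒲 := ⟨Prod.snd, fun _ => inf_le_right⟩
        exact ⟨𝒱.inf 𝒲, r.comp p, s'.comp q, ((H.restrict p).trans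
          (Cocycle.equivalent_restrict c'.2 (r'.comp p) (s.comp q))).trans (K.restrict q)⟩ }

variable (d X) in
/-- The non-abelian cohomology `H¹(X, Γ)` of the `d`-dimensional manifold `X` with values in
smooth `Γ`-valued functions. -/
def H1 (Γ : CrossedModule.{u, v, w}) : Type _ := Quotient (cocycleSetoid d X Γ)

namespace CrossedIntertwiner

variable {Γ : CrossedModule.{u, v, w}} {Γ' : CrossedModule.{u, v', w'}} (F : CrossedIntertwiner Γ Γ') {𝒰 𝒱 : OpenCover X}

theorem smoothOn_η {U : Opens X} {g g' : X → Γ.G} (hg : SmoothOn d g U) (hg' : SmoothOn d g' U) :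
    SmoothOn d (fun x => F.η (g x) (g' x)) U :=
  F.smooth_η d X (fun x => (g x, g' x)) U ⟨hg, hg'⟩

theorem smoothOn_mor {U : Opens X} {h : X → Γ.H} {g : X → Γ.G} (hh : SmoothOn d h U)
    (hg : SmoothOn d g U) : SmoothOn d (fun x => F.mor (h x) (g x)) U :=
  smoothOn_mul (smoothOn_inv (F.smoothOn_η (Γ.smooth_t d X h U hh) hg)) (F.smooth_f d X h U hh)

/-- The image `(g', a')` of a `Γ`-cocycle `(g, a)` under a crossed intertwiner:
`g'_ij = φ(g_ij)` and `a'_ijk = η(t(a_ijk), g_jk g_ij)⁻¹ f(a_ijk) η(g_jk, g_ij)⁻¹`. -/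
def mapCocycle (c : Cocycle d Γ 𝒰) : Cocycle d Γ' 𝒰 where
  g i j x := F.φ (c.g i j x)
  a i j k x := (F.η (Γ.t (c.a i j k x)) (c.g j k x * c.g i j x))⁻¹ * F.f (c.a i j k x) *
    (F.η (c.g j k x) (c.g i j x))⁻¹
  smooth_g i j := F.smooth_φ d X _ _ (c.smooth_g i j)
  smooth_a i j k := by
    have h1 := (c.smooth_g j k).mono
      (show 𝒰.U i ⊓ 𝒰.U j ⊓ 𝒰.U k ≤ _ from le_inf (inf_le_left.trans inf_le_right) inf_le_right)
    have h2 := (c.smooth_g i j).mono (show 𝒰.U i ⊓ 𝒰.U j ⊓ 𝒰.U k ≤ _ from inf_le_left)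
    exact smoothOn_mul (F.smoothOn_mor (c.smooth_a i j k) (smoothOn_mul h1 h2))
      (smoothOn_inv (F.smoothOn_η h1 h2))
  g_self i x hx := by rw [c.g_self i x hx, map_one]
  a_left i j x hx := by
    rw [c.a_left i j x hx, c.g_self i x hx.1]; simp [η_one_left, η_one_right]
  a_right i j x hx := by
    rw [c.a_right i j x hx, c.g_self j x hx.2]; simp [η_one_left]
  t_a i j k x hx := by
    simp only [map_mul, map_inv, F.t_η, inv_one, one_mul, mul_one]
    rw [← F.φ_t, ← map_mul, ← map_mul, c.t_a i j k x hx]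
  cocycle i j k l x hx := by
    have e1 := c.t_a i j k x hx.1
    have e2 := c.t_a j k l x ⟨⟨hx.1.1.2, hx.1.2⟩, hx.2⟩
    have e3 := c.cocycle i j k l x hx
    have A := F.α_mor (c.a i j k x) (c.g k l x) (c.g j k x * c.g i j x)
    have B := F.mor_eq (c.a j k l x) (c.g k l x * c.g j k x) (c.g i j x)
    have C := F.η_cocycle (c.g k l x) (c.g j k x) (c.g i j x)
    have D := F.mor_mul (c.a i k l x) (Γ.α (c.g k l x) (c.a i j k x))
      (c.g k l x * (c.g j k x * c.g i j x))
    have D' := F.mor_mul (c.a i j l x) (c.a j k l x) (c.g k l x * c.g j k x * c.g i j x)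
    rw [Γ.t_α, show c.g k l x * Γ.t (c.a i j k x) * (c.g k l x)⁻¹ *
      (c.g k l x * (c.g j k x * c.g i j x)) =
      c.g k l x * (Γ.t (c.a i j k x) * c.g j k x * c.g i j x) by group, e1] at D
    rw [← mul_assoc (Γ.t (c.a j k l x)), ← mul_assoc (Γ.t (c.a j k l x)), e2, ← e3,
      mul_assoc (c.g k l x), D] at D'
    rw [← mul_assoc (Γ.t (c.a i j k x)), e1] at A
    rw [← mul_assoc (Γ.t (c.a j k l x)), e2, mul_assoc (c.g k l x)] at B
    simp only [mor] at A B D'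
    rw [map_mul, map_inv, A, B, mul_assoc]
    simp only [mul_assoc, inv_mul_cancel_left] at D' ⊢
    rw [← mul_inv_rev, ← mul_inv_rev, C]
    simp only [← mul_assoc] at D' ⊢
    rw [D']

theorem mapCocycle_restrict (c : Cocycle d Γ 𝒰) (r : Refinement 𝒱 𝒰) :
    (F.mapCocycle c).restrict r = F.mapCocycle (c.restrict r) := rfl

theorem mul_aux {K : Type*} [Group K] {p P₁ r₁ y p' s₁ P₂ s₂ q' pj u₁ P₃ u₂ qj R q Q v₂ y' : K}
    (C₁ : y * r₁ = p' * s₁) (C₂ : pj * u₁ = q' * s₂) (C₃ : qj * u₂ = y' * v₂)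
    (D : P₁ * (P₂ * P₃) = R * Q) :
    p * P₁ * r₁⁻¹ * y⁻¹ * (p' * (s₁ * P₂ * s₂⁻¹) * q'⁻¹) * (pj * (u₁ * P₃ * u₂⁻¹) * qj⁻¹) =
      p * R * q⁻¹ * (q * Q * v₂⁻¹ * y'⁻¹) := by
  rw [eq_mul_inv_of_mul_eq C₁.symm, eq_mul_inv_of_mul_eq C₂, eq_mul_inv_of_mul_eq C₃,
    eq_mul_inv_of_mul_eq D]
  group

theorem mapCocycle_equivalent {c c' : Cocycle d Γ 𝒰} (H : c.Equivalent c') :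
    (F.mapCocycle c).Equivalent (F.mapCocycle c') := by
  obtain ⟨h, e, h1, h2, h3, h4, h5⟩ := H
  refine ⟨fun i x => F.φ (h i x), fun i j x => F.η (c'.g i j x) (h i x) *
    F.mor (e i j x) (h j x * c.g i j x) * (F.η (h j x) (c.g i j x))⁻¹,
    fun i => F.smooth_φ d X _ _ (h1 i), fun i j => ?_, fun i x hx => ?_, fun i j x hx => ?_,
    fun i j k x hx => ?_⟩
  · have hi := (h1 i).mono (show 𝒰.U i ⊓ 𝒰.U j ≤ _ from inf_le_left)
    have hj := (h1 j).mono (show 𝒰.U i ⊓ 𝒰.U j ≤ _ from inf_le_right)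
    exact smoothOn_mul (smoothOn_mul (F.smoothOn_η (c'.smooth_g i j) hi) (F.smoothOn_mor (h2 i j)
      (smoothOn_mul hj (c.smooth_g i j)))) (smoothOn_inv (F.smoothOn_η hj (c.smooth_g i j)))
  · beta_reduce
    rw [h3 i x hx, c.g_self i x hx, c'.g_self i x hx, η_one_left, η_one_right, mor_one]
    simp
  · have := congrArg F.φ (h4 i j x hx)
    simpa [F.t_η, F.t_mor, mapCocycle] using this
  · have hjk : x ∈ 𝒰.U j ⊓ 𝒰.U k := ⟨hx.1.2, hx.2⟩
    have e1 := h4 i j x hx.1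
    have e2 := h4 j k x hjk
    have e3 := c.t_a i j k x hx
    have e3' := c'.t_a i j k x hx
    have e5 := h5 i j k x hx
    have A1 := F.mor_eq (c'.a i j k x) (c'.g j k x * c'.g i j x) (h i x)
    have A2 := F.α_mor (e i j x) (c'.g j k x) (h j x * c.g i j x)
    have A3 := F.mor_eq (e j k x) (h k x * c.g j k x) (c.g i j x)
    have A4 := F.α_mor (c.a i j k x) (h k x) (c.g j k x * c.g i j x)
    have C1 := F.η_cocycle (c'.g j k x) (c'.g i j x) (h i x)
    have C2 := F.η_cocycle (c'.g j k x) (h j x) (c.g i j x)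
    have C3 := F.η_cocycle (h k x) (c.g j k x) (c.g i j x)
    rw [← mul_assoc (Γ.t _), e3'] at A1
    rw [← mul_assoc (Γ.t _), e1] at A2
    rw [← mul_assoc (Γ.t _), e2] at A3
    rw [← mul_assoc (Γ.t _), e3] at A4
    have D : F.mor (c'.a i j k x) (c'.g j k x * c'.g i j x * h i x) *
        (F.mor (Γ.α (c'.g j k x) (e i j x)) (c'.g j k x * (h j x * c.g i j x)) *
        F.mor (e j k x) (h k x * c.g j k x * c.g i j x)) =
        F.mor (e i k x) (h k x * c.g i k x) *
        F.mor (Γ.α (h k x) (c.a i j k x)) (h k x * (c.g j k x * c.g i j x)) := by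
      have b1 : c'.g j k x * (h j x * c.g i j x) =
          Γ.t (e j k x) * (h k x * c.g j k x * c.g i j x) := by
        rw [← mul_assoc, ← e2]; simp only [mul_assoc]
      have b2 : c'.g j k x * c'.g i j x * h i x = Γ.t (Γ.α (c'.g j k x) (e i j x) * e j k x) *
          (h k x * c.g j k x * c.g i j x) := by
        rw [map_mul, mul_assoc (Γ.t _), ← b1, Γ.t_α, mul_assoc (c'.g j k x), ← e1]
        group
      have b3 : h k x * c.g i k x = Γ.t (Γ.α (h k x) (c.a i j k x)) *
          (h k x * (c.g j k x * c.g i j x)) := by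
        rw [← e3, Γ.t_α]; group
      rw [b1, ← F.mor_mul, b2, ← F.mor_mul, b3, ← F.mor_mul, ← mul_assoc, e5,
        mul_assoc (h k x)]
    change F.mor (c'.a i j k x) (c'.g j k x * c'.g i j x) *
        (F.η (c'.g j k x) (c'.g i j x))⁻¹ * Γ'.α (F.φ (c'.g j k x)) (F.η (c'.g i j x) (h i x) *
          F.mor (e i j x) (h j x * c.g i j x) * (F.η (h j x) (c.g i j x))⁻¹) *
        (F.η (c'.g j k x) (h j x) * F.mor (e j k x) (h k x * c.g j k x) *
          (F.η (h k x) (c.g j k x))⁻¹) =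
      F.η (c'.g i k x) (h i x) * F.mor (e i k x) (h k x * c.g i k x) *
        (F.η (h k x) (c.g i k x))⁻¹ * Γ'.α (F.φ (h k x)) (F.mor (c.a i j k x)
          (c.g j k x * c.g i j x) * (F.η (c.g j k x) (c.g i j x))⁻¹)
    simp only [map_mul (Γ'.α _), map_inv (Γ'.α _)]
    rw [A1, A2, A3, A4]
    exact mul_aux C1 C2 C3 D

/-- The map in cohomology induced by a crossed intertwiner. -/
def mapH1 : H1 d X Γ → H1 d X Γ' :=
  Quotient.map (fun c => ⟨c.1, F.mapCocycle c.2⟩) fun _ _ ⟨𝒱, r, r', H⟩ =>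
    ⟨𝒱, r, r', F.mapCocycle_equivalent H⟩

end CrossedIntertwiner

end Cohomology

/-! ### The Lie 2-groups of topological T-duality -/

open Real in
/-- The quotient map `ℝ → ℝ/ℤ = U(1)`. -/
noncomputable def expU (r : ℝ) : Circle := Circle.exp (2 * π * r)

theorem expU_add (r s : ℝ) : expU (r + s) = expU r * expU s := by
  simp [expU, mul_add, Circle.exp_add]

theorem expU_zero : expU 0 = 1 := by simp [expU]

theorem expU_neg (r : ℝ) : expU (-r) = (expU r)⁻¹ := by simp [expU]

theorem expU_intCast (k : ℤ) : expU k = 1 := by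
  rw [expU, mul_comm]
  exact Circle.exp_int_mul_two_pi k

theorem contMDiff_expU : ContMDiff 𝓘(ℝ, ℝ) (𝓡 1) ∞ expU :=
  contMDiff_circleExp.comp (contDiff_const.mul contDiff_id).contMDiff

/-- The torus `𝕋ⁿ = U(1)ⁿ`, a smooth manifold modelled on `torusModel n`. -/
abbrev Torus (n : ℕ) : Type := Fin n → Circle

noncomputable abbrev torusModel (n : ℕ) : ModelWithCorners ℝ (Fin n → EuclideanSpace ℝ (Fin 1))
    (ModelPi fun _ : Fin n => EuclideanSpace ℝ (Fin 1)) :=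
  ModelWithCorners.pi fun _ : Fin n => 𝓡 1

section

variable {E : Type*} [NormedAddCommGroup E] [NormedSpace ℝ E] {H : Type*} [TopologicalSpace H]
  {I : ModelWithCorners ℝ E H} {M : Type*} [TopologicalSpace M] [ChartedSpace H M]

theorem contMDiffWithinAt_torus {n : ℕ} {k : ℕ∞ω} {f : M → Torus n} {s : Set M} {x : M} :
    ContMDiffWithinAt I (torusModel n) k f s x ↔
      ∀ i, ContMDiffWithinAt I (𝓡 1) k (fun y => f y i) s x := by
  simp only [contMDiffWithinAt_iff, continuousWithinAt_pi, forall_and]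
  refine and_congr Iff.rfl ?_
  rw [← contDiffWithinAt_pi]
  rfl

theorem contMDiffOn_torus {n : ℕ} {k : ℕ∞ω} {f : M → Torus n} {s : Set M} :
    ContMDiffOn I (torusModel n) k f s ↔ ∀ i, ContMDiffOn I (𝓡 1) k (fun y => f y i) s :=
  ⟨fun h i x hx => contMDiffWithinAt_torus.1 (h x hx) i,
    fun h x hx => contMDiffWithinAt_torus.2 fun i => h i x hx⟩

theorem contMDiff_torus_apply {n : ℕ} {k : ℕ∞ω} (i : Fin n) :
    ContMDiff (torusModel n) (𝓡 1) k (fun c : Torus n => c i) := fun _ =>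
  contMDiffWithinAt_torus.1 contMDiffWithinAt_id i

end

/-- The translate `c - a` of a point `c ∈ 𝕋ⁿ` by `a ∈ ℝⁿ` (with `𝕋ⁿ` written additively). -/
noncomputable def torusSub {n : ℕ} (c : Torus n) (a : Fin n → ℝ) : Torus n :=
  fun i => c i * expU (-a i)

/-- The group `C^∞(𝕋ⁿ, U(1))`. -/
abbrev TorusFun (n : ℕ) : Type := C^∞⟮torusModel n, Torus n; 𝓡 1, Circle⟯

theorem contMDiff_torusSub {n : ℕ} (a : Fin n → ℝ) :
    ContMDiff (torusModel n) (torusModel n) ∞ fun c => torusSub c a := by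
  rw [← contMDiffOn_univ, contMDiffOn_torus]
  intro i
  exact ((contMDiff_torus_apply i).mul contMDiff_const).contMDiffOn

/-- The translate `c ↦ τ(c - a)` of `τ ∈ C^∞(𝕋ⁿ, U(1))` by `a ∈ ℝⁿ`. -/
noncomputable def translate {n : ℕ} (a : Fin n → ℝ) (τ : TorusFun n) : TorusFun n :=
  ⟨fun c => τ (torusSub c a), τ.contMDiff.comp (contMDiff_torusSub a)⟩

/-- The Fréchet smooth structure of `C^∞(𝕋ⁿ, U(1))`: a map `U → C^∞(𝕋ⁿ, U(1))` is smooth if and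
only if the adjoint map `U × 𝕋ⁿ → U(1)` is smooth. -/
noncomputable instance instSmoothSpaceTorusFun.{u} (n : ℕ) : SmoothSpace.{u} (TorusFun n) where
  SmoothOn d X _ _ _ f U := ContMDiffOn ((𝓡 d).prod (torusModel n)) (𝓡 1) ∞
    (fun p : X × Torus n => f p.1 p.2) ((U : Set X) ×ˢ univ)
  smoothOn_const d X _ _ _ s U := (s.contMDiff.comp contMDiff_snd).contMDiffOn
  smoothOn_comp d d' X Y _ _ _ _ _ _ f U p V hp hpVU hf :=
    hf.comp (t := (U : Set X) ×ˢ univ) (f := fun q : Y × Torus n => (p q.1, q.2))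
      ((hp.comp contMDiffOn_fst fun q hq => hq.1).prodMk contMDiffOn_snd)
      fun q hq => ⟨hpVU hq.1, trivial⟩
  smoothOn_of_locally d X _ _ _ f U h := contMDiffOn_of_locally_contMDiffOn fun q hq =>
    let ⟨W, hW, h'⟩ := h q.1 hq.1
    ⟨(W : Set X) ×ˢ univ, W.isOpen.prod isOpen_univ, ⟨hW, trivial⟩, by
      rw [Set.prod_inter_prod, univ_inter]; exact h'⟩
  smoothOn_congr d X _ _ _ f g U h hf := hf.congr fun q hq => by rw [h q.1 hq.1]

noncomputable instance instSmoothGroupTorusFun.{u} (n : ℕ) : SmoothGroup.{u} (TorusFun n) where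
  smooth_mul d X _ _ _ f U hf := by
    have h1 : ContMDiffOn ((𝓡 d).prod (torusModel n)) (𝓡 1) ∞
      (fun p : X × Torus n => (f p.1).1 p.2) ((U : Set X) ×ˢ univ) := hf.1
    have h2 : ContMDiffOn ((𝓡 d).prod (torusModel n)) (𝓡 1) ∞
      (fun p : X × Torus n => (f p.1).2 p.2) ((U : Set X) ×ˢ univ) := hf.2
    exact h1.mul h2
  smooth_inv d X _ _ _ f U hf := ContMDiffOn.inv (I := 𝓡 1) hf

noncomputable instance instSmoothGroupCircle.{u} : SmoothGroup.{u} Circle where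
  toSmoothSpace := SmoothSpace.ofManifold (𝓡 1) Circle
  smooth_mul d X _ _ _ f U hf := by
    have h1 : ContMDiffOn (𝓡 d) (𝓡 1) ∞ (fun x => (f x).1) (U : Set X) := hf.1
    have h2 : ContMDiffOn (𝓡 d) (𝓡 1) ∞ (fun x => (f x).2) (U : Set X) := hf.2
    exact h1.mul h2
  smooth_inv d X _ _ _ f U hf := ContMDiffOn.inv (I := 𝓡 1) hf

noncomputable instance instSmoothSpaceReal.{u} (n : ℕ) : SmoothSpace.{u} (Fin n → ℝ) :=
  SmoothSpace.ofManifold 𝓘(ℝ, Fin n → ℝ) (Fin n → ℝ)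

noncomputable instance instSmoothGroupReal.{u} (n : ℕ) :
    SmoothGroup.{u} (Multiplicative (Fin n → ℝ)) where
  smooth_mul d X _ _ _ f U hf := by
    have h1 : ContMDiffOn (𝓡 d) 𝓘(ℝ, Fin n → ℝ) ∞ (fun x => (f x).1.toAdd) (U : Set X) := hf.1
    have h2 : ContMDiffOn (𝓡 d) 𝓘(ℝ, Fin n → ℝ) ∞ (fun x => (f x).2.toAdd) (U : Set X) := hf.2
    exact h1.add h2
  smooth_inv d X _ _ _ f U hf := ContMDiffOn.neg (I := 𝓘(ℝ, Fin n → ℝ)) hf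

instance instSmoothSpaceInt.{u} (n : ℕ) : SmoothSpace.{u} (Fin n → ℤ) :=
  SmoothSpace.discrete _

instance instSmoothGroupInt.{u} (n : ℕ) : SmoothGroup.{u} (Multiplicative (Fin n → ℤ)) where
  smooth_mul d X _ _ _ f U hf := fun x hx => by
    filter_upwards [hf.1 x hx, hf.2 x hx] with y h1 h2
    rw [h1, h2]
  smooth_inv d X _ _ _ f U hf := fun x hx => by
    filter_upwards [hf x hx] with y h1
    rw [h1]

instance instSmoothGroupProd.{u, v, w} {G : Type v} {H : Type w} [Group G] [Group H]
    [SmoothGroup.{u} G] [SmoothGroup.{u} H] : SmoothGroup.{u} (G × H) where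
  smooth_mul d X _ _ _ f U hf :=
    ⟨SmoothGroup.smooth_mul d X (fun x => ((f x).1.1, (f x).2.1)) U ⟨hf.1.1, hf.2.1⟩,
      SmoothGroup.smooth_mul d X (fun x => ((f x).1.2, (f x).2.2)) U ⟨hf.1.2, hf.2.2⟩⟩
  smooth_inv d X _ _ _ f U hf :=
    ⟨SmoothGroup.smooth_inv d X (fun x => (f x).1) U hf.1,
      SmoothGroup.smooth_inv d X (fun x => (f x).2) U hf.2⟩

/-- The inclusion `ℤⁿ → ℝⁿ` (groups written multiplicatively). -/
def intToReal (n : ℕ) : Multiplicative (Fin n → ℤ) →* Multiplicative (Fin n → ℝ) where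
  toFun m := .ofAdd fun i => (m.toAdd i : ℝ)
  map_one' := by ext i; simp
  map_mul' m m' := by ext i; simp

theorem smooth_intToReal.{u} (n : ℕ) : IsSmoothMap.{u} fun m => intToReal n m := by
  intro d X _ _ _ f U hf x hx
  refine ContMDiffAt.contMDiffWithinAt ?_
  exact (contMDiffAt_const (c := fun i => ((f x).toAdd i : ℝ))).congr_of_eventuallyEq (by
    filter_upwards [hf x hx] with y hy
    change Multiplicative.toAdd (intToReal n (f y)) = _
    rw [hy]
    rfl)

/-- A group action by group homomorphisms as a homomorphism to the automorphism group. -/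
def mulAutOfAction {G H : Type*} [Group G] [Group H] (act : G → H → H) (h_one : ∀ h, act 1 h = h)
    (h_mul : ∀ g g' h, act (g * g') h = act g (act g' h))
    (h_hom : ∀ g h h', act g (h * h') = act g h * act g h') : G →* MulAut H where
  toFun g :=
    { toFun := act g
      invFun := act g⁻¹
      left_inv := fun h => by rw [← h_mul, inv_mul_cancel, h_one]
      right_inv := fun h => by rw [← h_mul, mul_inv_cancel, h_one]
      map_mul' := h_hom g }
  map_one' := MulEquiv.ext h_one
  map_mul' g g' := MulEquiv.ext (h_mul g g')

theorem contMDiff_dotProduct (n : ℕ) :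
    ContMDiff 𝓘(ℝ, (Fin n → ℝ) × (Fin n → ℝ)) 𝓘(ℝ, ℝ) ∞
      fun p : (Fin n → ℝ) × (Fin n → ℝ) => dotProduct p.1 p.2 := by
  refine ContDiff.contMDiff ?_
  unfold dotProduct
  fun_prop

theorem smoothOn_expU_dot.{u} {n d : ℕ} {X : Type u} [TopologicalSpace X]
    [ChartedSpace (EuclideanSpace ℝ (Fin d)) X] [IsManifold (𝓡 d) ∞ X] {U : Opens X}
    {f g : X → Fin n → ℝ} (hf : SmoothOn d f U) (hg : SmoothOn d g U) :
    SmoothOn d (fun x => expU (dotProduct (f x) (g x))) U := by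
  have h1 : ContMDiffOn (𝓡 d) 𝓘(ℝ, Fin n → ℝ) ∞ f (U : Set X) := hf
  have h2 : ContMDiffOn (𝓡 d) 𝓘(ℝ, Fin n → ℝ) ∞ g (U : Set X) := hg
  exact contMDiff_expU.comp_contMDiffOn
    ((contMDiff_dotProduct n).comp_contMDiffOn (h1.prodMk_space h2))

theorem expU_dot_int {n : ℕ} (m m' : Fin n → ℤ) :
    expU (dotProduct (fun i => (m i : ℝ)) (fun i => (m' i : ℝ))) = 1 := by
  rw [← expU_intCast (dotProduct m m')]
  simp [dotProduct]

/-- The T-duality 2-group `𝕋𝔻[n]`, the categorical torus of the bilinear form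
`[a ⊕ â, a' ⊕ â'] = â · a'` on `ℝ²ⁿ`: `G = ℝ²ⁿ`, `H = ℤ²ⁿ × U(1)`, `t(z, s) = z` and
`α(x, (z, s)) = (z, s - [x, z])`. -/
noncomputable def TD.{u} (n : ℕ) : CrossedModule.{u, 0, 0} where
  G := Multiplicative (Fin n → ℝ) × Multiplicative (Fin n → ℝ)
  H := (Multiplicative (Fin n → ℤ) × Multiplicative (Fin n → ℤ)) × Circle
  t := ((intToReal n).prodMap (intToReal n)).comp (MonoidHom.fst _ _)
  α := mulAutOfAction
    (fun x h => (h.1, h.2 * expU (-dotProduct x.2.toAdd (intToReal n h.1.1).toAdd)))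
    (fun h => by simp [expU_zero])
    (fun x x' h => by simp [expU_add, mul_comm, mul_left_comm])
    (fun x h h' => by simp [expU_add, mul_comm, mul_left_comm, mul_assoc])
  smooth_t d X _ _ _ f U hf := by
    have h1 : SmoothOn d (fun x => (f x).1) U ∧ SmoothOn d (fun x => (f x).2) U := hf
    have h2 : SmoothOn d (fun x => (f x).1.1) U ∧ SmoothOn d (fun x => (f x).1.2) U := h1.1
    exact And.intro (smooth_intToReal n d X _ U h2.1) (smooth_intToReal n d X _ U h2.2)
  smooth_α d X _ _ _ f U hf := by
    have h1 : SmoothOn d (fun x => (f x).1.1) U ∧ SmoothOn d (fun x => (f x).1.2) U := hf.1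
    have h2 : SmoothOn d (fun x => (f x).2.1) U ∧ SmoothOn d (fun x => (f x).2.2) U := hf.2
    have h3 : SmoothOn d (fun x => (f x).2.1.1) U ∧ SmoothOn d (fun x => (f x).2.1.2) U := h2.1
    have h4 : SmoothOn d (fun x => expU (-dotProduct (f x).1.2.toAdd
        (intToReal n (f x).2.1.1).toAdd)) U := by
      simp only [expU_neg]
      exact smoothOn_inv (smoothOn_expU_dot h1.2 (smooth_intToReal n d X _ U h3.1))
    exact And.intro h2.1 (smoothOn_mul h2.2 h4)
  α_t h h' := by
    have := expU_dot_int h.1.2.toAdd h'.1.1.toAdd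
    refine Prod.ext ?_ ?_
    · simp [mulAutOfAction]
    · simp [mulAutOfAction, intToReal, expU_neg, this]
  t_α x h := by simp [mulAutOfAction]

theorem translate_zero {n : ℕ} (τ : TorusFun n) : translate 0 τ = τ := by
  apply ContMDiffMap.ext
  intro c
  change τ _ = τ _
  congr 1
  funext i
  simp [torusSub, expU_zero]

theorem translate_add {n : ℕ} (a b : Fin n → ℝ) (τ : TorusFun n) :
    translate (a + b) τ = translate a (translate b τ) := by
  apply ContMDiffMap.ext
  intro c
  change τ _ = τ _
  congr 1
  funext i
  simp [torusSub, expU_add, mul_comm, mul_assoc]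

theorem translate_mul {n : ℕ} (a : Fin n → ℝ) (τ σ : TorusFun n) :
    translate a (τ * σ) = translate a τ * translate a σ := rfl

theorem translate_int {n : ℕ} (m : Multiplicative (Fin n → ℤ)) (τ : TorusFun n) :
    translate (intToReal n m).toAdd τ = τ := by
  apply ContMDiffMap.ext
  intro c
  change τ _ = τ _
  congr 1
  funext i
  simp [torusSub, intToReal, expU_neg, expU_intCast]

theorem smoothOn_translate.{u} {n d : ℕ} {X : Type u} [TopologicalSpace X]
    [ChartedSpace (EuclideanSpace ℝ (Fin d)) X] [IsManifold (𝓡 d) ∞ X] {U : Opens X}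
    {a : X → Fin n → ℝ} {τ : X → TorusFun n} (ha : SmoothOn d a U) (hτ : SmoothOn d τ U) :
    SmoothOn d (fun x => translate (a x) (τ x)) U := by
  have h1 : ContMDiffOn (𝓡 d) 𝓘(ℝ, Fin n → ℝ) ∞ a (U : Set X) := ha
  have h2 : ContMDiffOn ((𝓡 d).prod (torusModel n)) (𝓡 1) ∞
    (fun p : X × Torus n => τ p.1 p.2) ((U : Set X) ×ˢ univ) := hτ
  refine h2.comp (t := (U : Set X) ×ˢ univ)
    (f := fun p : X × Torus n => (p.1, torusSub p.2 (a p.1)))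
    (contMDiffOn_fst.prodMk (contMDiffOn_torus.2 fun i => ?_)) fun q hq => ⟨hq.1, trivial⟩
  refine ((contMDiff_torus_apply i).comp contMDiff_snd).contMDiffOn.mul ?_
  refine contMDiff_expU.comp_contMDiffOn ?_
  have h3 := contMDiffOn_pi_space.1 (h1.comp (contMDiffOn_fst (J := torusModel n) (N := Torus n)
    (s := (U : Set X) ×ˢ univ)) fun q hq => hq.1) i
  exact h3.neg

/-- The 2-group `𝕋𝔹^R_{F2}[n]` of `F₂` T-backgrounds: `G = ℝⁿ`, `H = C^∞(𝕋ⁿ, U(1)) × ℤⁿ`,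
`t(τ, m) = m` and `α(a, (τ, m)) = (τ(· - a), m)`. -/
noncomputable def TBF2R.{u} (n : ℕ) : CrossedModule.{u, 0, 0} where
  G := Multiplicative (Fin n → ℝ)
  H := TorusFun n × Multiplicative (Fin n → ℤ)
  t := (intToReal n).comp (MonoidHom.snd _ _)
  α := mulAutOfAction (fun a h => (translate a.toAdd h.1, h.2))
    (fun h => by simp [translate_zero])
    (fun a b h => by simp [translate_add])
    (fun a h h' => by simp [translate_mul])
  smooth_t d X _ _ _ f U hf := smooth_intToReal n d X _ U (And.right (a := SmoothOn d (fun x => (f x).1) U) hf)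
  smooth_α d X _ _ _ f U hf := by
    have h2 : SmoothOn d (fun x => (f x).2.1) U ∧ SmoothOn d (fun x => (f x).2.2) U := hf.2
    exact And.intro (smoothOn_translate hf.1 h2.1) h2.2
  α_t h h' := by
    refine Prod.ext ?_ ?_
    · simpa [mulAutOfAction] using translate_int h.2 h'.1
    · simp [mulAutOfAction]
  t_α a h := by simp [mulAutOfAction]

theorem contMDiff_zpow {E : Type*} [NormedAddCommGroup E] [NormedSpace ℝ E] {H : Type*}
    [TopologicalSpace H] {I : ModelWithCorners ℝ E H} {M : Type*} [TopologicalSpace M]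
    [ChartedSpace H M] {f : M → Circle} (hf : ContMDiff I (𝓡 1) ∞ f) (k : ℤ) :
    ContMDiff I (𝓡 1) ∞ fun x => f x ^ k := by
  rcases k with k | k
  · simpa [Function.comp_def] using (contMDiff_pow (I := 𝓡 1) (G := Circle) k).comp hf
  · simpa [Function.comp_def] using ((contMDiff_pow (I := 𝓡 1) (G := Circle) (k + 1)).comp hf).inv

/-- The function `c ↦ m · c` on `𝕋ⁿ` (with `U(1)` and `𝕋ⁿ` written additively). -/
noncomputable def character {n : ℕ} (m : Fin n → ℤ) : TorusFun n :=
  ⟨fun c => ∏ i, c i ^ m i, contMDiff_finsetProd fun i _ =>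
    contMDiff_zpow (contMDiff_torus_apply i) (m i)⟩

/-- The constant function with value `s` on `𝕋ⁿ`. -/
def constFun (n : ℕ) (s : Circle) : TorusFun n :=
  ⟨fun _ => s, contMDiff_const⟩

theorem constFun_apply {n : ℕ} (s : Circle) (c : Torus n) : constFun n s c = s := rfl

theorem smoothOn_constFun.{u} {n d : ℕ} {X : Type u} [TopologicalSpace X]
    [ChartedSpace (EuclideanSpace ℝ (Fin d)) X] [IsManifold (𝓡 d) ∞ X] {U : Opens X}
    {s : X → Circle} (hs : SmoothOn d s U) : SmoothOn d (fun x => constFun n (s x)) U := by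
  have h1 : ContMDiffOn (𝓡 d) (𝓡 1) ∞ s (U : Set X) := hs
  exact h1.comp (contMDiffOn_fst (J := torusModel n) (N := Torus n)
    (s := (U : Set X) ×ˢ univ)) fun q hq => hq.1

theorem smoothOn_character.{u} {n d : ℕ} {X : Type u} [TopologicalSpace X]
    [ChartedSpace (EuclideanSpace ℝ (Fin d)) X] [IsManifold (𝓡 d) ∞ X] {U : Opens X}
    {m : X → Multiplicative (Fin n → ℤ)} (hm : SmoothOn d m U) :
    SmoothOn d (fun x => character (m x).toAdd) U := by
  refine SmoothSpace.smoothOn_of_locally d _ U fun x hx => ?_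
  obtain ⟨W, hW, hWo, hxW⟩ := eventually_nhds_iff.1 (hm x hx)
  refine ⟨⟨W, hWo⟩, hxW, SmoothSpace.smoothOn_congr d _ _ _ ?_
    (SmoothSpace.smoothOn_const d (character (m x).toAdd) _)⟩
  intro y hy
  rw [hW y hy.2]

theorem expU_zsmul (k : ℤ) (r : ℝ) : expU (k * r) = expU r ^ k := by
  simp only [expU]
  rw [mul_left_comm, ← Circle.exp_intCast_mul]

theorem expU_sum {n : ℕ} (r : Fin n → ℝ) : expU (∑ i, r i) = ∏ i, expU (r i) :=
  map_sum (⟨⟨fun x : ℝ => Additive.ofMul (expU x), congrArg _ expU_zero⟩,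
    fun x y => congrArg Additive.ofMul (expU_add x y)⟩ : ℝ →+ Additive Circle) r Finset.univ

theorem translate_character {n : ℕ} (a : Fin n → ℝ) (m : Fin n → ℤ) :
    translate a (character m) =
      character m * constFun n (expU (-dotProduct a fun i => (m i : ℝ))) := by
  apply ContMDiffMap.ext
  intro c
  change ∏ i, (c i * expU (-a i)) ^ m i = (∏ i, c i ^ m i) * _
  simp only [mul_zpow, Finset.prod_mul_distrib, ← expU_zsmul, ← expU_sum]
  congr 1
  simp [dotProduct, constFun_apply, mul_comm]

theorem translate_constFun {n : ℕ} (a : Fin n → ℝ) (s : Circle) :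
    translate a (constFun n s) = constFun n s := rfl

theorem character_one {n : ℕ} : character (0 : Fin n → ℤ) = 1 := by
  apply ContMDiffMap.ext
  intro c
  change ∏ i, c i ^ (0 : ℤ) = 1
  simp

theorem character_add {n : ℕ} (m m' : Fin n → ℤ) :
    character (m + m') = character m * character m' := by
  apply ContMDiffMap.ext
  intro c
  change ∏ i, c i ^ (m i + m' i) = (∏ i, c i ^ m i) * ∏ i, c i ^ m' i
  simp only [zpow_add, Finset.prod_mul_distrib]

theorem constFun_one {n : ℕ} : constFun n 1 = 1 := rfl

theorem constFun_mul {n : ℕ} (s s' : Circle) :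
    constFun n (s * s') = constFun n s * constFun n s' := rfl

/-- The left leg projection `𝕋𝔻[n] → 𝕋𝔹^R_{F2}[n]`, i.e. the crossed intertwiner `(φ, f, η)` with
`φ(a ⊕ â) = a`, `f(m ⊕ m̂, s) = (c ↦ s + m̂ · c, m)` and `η(a ⊕ â, a' ⊕ â')(c) = â · a'`. -/
noncomputable def leftLeg.{u} (n : ℕ) : CrossedIntertwiner (TD.{u} n) (TBF2R.{u} n) where
  φ := MonoidHom.fst (Multiplicative (Fin n → ℝ)) (Multiplicative (Fin n → ℝ))
  f :=
    { toFun := fun h : (Multiplicative (Fin n → ℤ) × Multiplicative (Fin n → ℤ)) × Circle =>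
        ((constFun n h.2 * character h.1.2.toAdd, h.1.1) :
          TorusFun n × Multiplicative (Fin n → ℤ))
      map_one' := by
        refine Prod.ext ?_ rfl
        change constFun n 1 * character 0 = 1
        rw [character_one, constFun_one, one_mul]
      map_mul' := fun h h' => by
        refine Prod.ext ?_ rfl
        change constFun n (h.2 * h'.2) * character (h.1.2.toAdd + h'.1.2.toAdd) =
          constFun n h.2 * character h.1.2.toAdd * (constFun n h'.2 * character h'.1.2.toAdd)
        rw [character_add, constFun_mul, mul_mul_mul_comm] }
  η := fun (x x' : Multiplicative (Fin n → ℝ) × Multiplicative (Fin n → ℝ)) =>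
    ((constFun n (expU (dotProduct x.2.toAdd x'.1.toAdd)), 1) :
      TorusFun n × Multiplicative (Fin n → ℤ))
  smooth_φ d X _ _ _ f U hf := And.left
    (b := SmoothOn d (fun x => (f x).2) U) hf
  smooth_f d X _ _ _ f U hf := by
    have h1 : SmoothOn d (fun x => (f x).1) U ∧ SmoothOn d (fun x => (f x).2) U := hf
    have h2 : SmoothOn d (fun x => (f x).1.1) U ∧ SmoothOn d (fun x => (f x).1.2) U := h1.1
    exact And.intro (smoothOn_mul (smoothOn_constFun h1.2) (smoothOn_character h2.2)) h2.1
  smooth_η d X _ _ _ f U hf := by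
    have h1 : SmoothOn d (fun x => (f x).1.1) U ∧ SmoothOn d (fun x => (f x).1.2) U := hf.1
    have h2 : SmoothOn d (fun x => (f x).2.1) U ∧ SmoothOn d (fun x => (f x).2.2) U := hf.2
    exact And.intro (smoothOn_constFun (smoothOn_expU_dot h1.2 h2.1))
      (SmoothSpace.smoothOn_const d 1 U)
  t_η x x' := map_one (intToReal n)
  φ_t h := rfl
  η_t h h' := Prod.ext (congrArg (constFun n) (expU_dot_int h.1.2.toAdd h'.1.1.toAdd)) rfl
  η_f x h := by
    refine Prod.ext ?_ rfl
    change constFun n (expU (dotProduct x.2.toAdd ((intToReal n h.1.1).toAdd + -x.1.toAdd))) *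
        (constFun n (h.2 * expU (-dotProduct x.2.toAdd (intToReal n h.1.1).toAdd)) *
          character h.1.2.toAdd) =
      translate x.1.toAdd (constFun n (expU (dotProduct ((intToReal n h.1.2).toAdd + -x.2.toAdd)
        x.1.toAdd))) * translate x.1.toAdd (constFun n h.2 * character h.1.2.toAdd)
    rw [translate_mul, translate_constFun, translate_constFun, translate_character]
    rw [mul_comm (character _), ← mul_assoc, ← mul_assoc, ← mul_assoc, ← constFun_mul,
      ← constFun_mul, ← constFun_mul]
    congr 2
    rw [mul_left_comm, mul_comm _ h.2, mul_assoc h.2, ← expU_add, ← expU_add]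
    congr 2
    rw [dotProduct_add, add_dotProduct, dotProduct_neg, neg_dotProduct,
      dotProduct_comm (intToReal n h.1.2).toAdd]
    change _ = _ + -dotProduct x.1.toAdd (intToReal n h.1.2).toAdd
    ring
  η_cocycle x x' x'' := by
    refine Prod.ext ?_ rfl
    change constFun n (expU (dotProduct x.2.toAdd x'.1.toAdd)) *
        constFun n (expU (dotProduct (x.2.toAdd + x'.2.toAdd) x''.1.toAdd)) =
      translate x.1.toAdd (constFun n (expU (dotProduct x'.2.toAdd x''.1.toAdd))) *
        constFun n (expU (dotProduct x.2.toAdd (x'.1.toAdd + x''.1.toAdd)))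
    rw [translate_constFun, ← constFun_mul, ← constFun_mul, ← expU_add, ← expU_add]
    congr 2
    rw [add_dotProduct, dotProduct_add]
    ring

end TDuality

/-!
The left leg projection is a bijection on cohomology because the two crossed modules differ by a
fine sheaf and by the resolution of `ℤⁿ` by real functions.

Lifting along `ℝ → U(1)` shows that every smooth `τ : 𝕋ⁿ → U(1)` is uniquely of the form
`τ(c) = τ(0) + m̂ · c + ρ(c)` with a winding number `m̂ ∈ ℤⁿ` and a smooth real function `ρ`
vanishing at `0` (`exists_isLogOf`, `IsLogOf.unique`). Uniqueness makes `winding` and `logPart`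
additive and compatible with translations, the latter up to constants, and compactness of the torus
shows that they depend smoothly on parameters (`eventually_isLogOf`).

The logarithmic parts of the 2-cells of a `𝕋𝔹^R_{F2}`-cocycle satisfy, up to constants, a twisted
cocycle condition with real coefficients. Averaging over a smooth partition of unity therefore
removes them (`logPart_eq_zero_of_average`): every cocycle is equivalent to an affine one, whose
2-cells are `c ↦ s + m̂ · c` (`TBF2R.exists_equivalent_affine`), and likewise equivalences between
affine cocycles can be made affine (`TBF2R.exists_affine_equivalence`). The constants produced on
the way are absorbed into `s`, so no integration over the torus is needed.

For an affine cocycle, the `m̂_ijk` form an integral 2-cocycle; another average writes it as the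
coboundary of real functions `â_ij`. Together with the phases `s + m̂ · (a_jk + a_ij) + â_jk · a_ij`
these are a `𝕋𝔻`-cocycle with the given image (`TD.ofAffine`), which gives surjectivity. For
injectivity, an affine equivalence between images has winding numbers `n̂_ij` for which
`n̂_ij + â_ij - â'_ij` is a real 1-cocycle; writing it as a coboundary of functions `ĥ_i` lifts the
equivalence to `𝕋𝔻` (`TD.equivalent_of_mapCocycle`). In both cases the condition in `U(1)` is an
identity of bilinear expressions modulo `ℤ` (`phase_cocycle`, `phase_equivalence`).
-/

namespace TDuality

open SmoothSpace Filter Topology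

/-! ### A smooth local logarithm on `U(1)` -/

/-- The branch of the inverse of `expU` on `U(1)` with values in `(-1/2, 1/2]`. -/
noncomputable def circleLog (z : Circle) : ℝ := Complex.arg z / (2 * Real.pi)

theorem expU_circleLog (z : Circle) : expU (circleLog z) = z := by
  rw [expU, circleLog, mul_div_cancel₀ _ (by positivity), Circle.exp_arg]

theorem circleLog_expU {r : ℝ} (h : |r| < 1 / 2) : circleLog (expU r) = r := by
  have hπ := Real.pi_pos
  obtain ⟨h1, h2⟩ := abs_lt.1 h
  rw [circleLog, expU, Circle.arg_exp (by nlinarith) (by nlinarith)]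
  field_simp

theorem contMDiffAt_circleLog {z : Circle} (hz : (z : ℂ) ∈ Complex.slitPlane) :
    ContMDiffAt (𝓡 1) 𝓘(ℝ, ℝ) ∞ circleLog z := by
  have : Fact (Module.finrank ℝ ℂ = 1 + 1) := finrank_real_complex_fact'
  have h1 : ContMDiffAt (𝓡 1) 𝓘(ℝ, ℂ) ∞ (fun z : Circle => (z : ℂ)) z :=
    (contMDiff_coe_sphere (E := ℂ) (n := 1)).contMDiffAt
  have h2 : ContDiffAt ℝ ∞ (fun w : ℂ => (Complex.log w).im / (2 * Real.pi)) (z : ℂ) :=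
    (Complex.imCLM.contDiff.contDiffAt.comp (z : ℂ)
      ((Complex.contDiffAt_log hz).restrict_scalars ℝ)).div_const _
  refine (h2.contMDiffAt.comp z h1).congr_of_eventuallyEq (Eventually.of_forall fun w => ?_)
  simp only [circleLog, ← Complex.log_im]
  rfl

theorem expU_eq_one_iff {r : ℝ} : expU r = 1 ↔ ∃ k : ℤ, r = k := by
  rw [expU, Circle.exp_eq_one]
  refine exists_congr fun k => ?_
  rw [mul_comm, mul_left_inj' (by positivity)]

theorem expU_eq_iff {r s : ℝ} : expU r = expU s ↔ ∃ k : ℤ, r = s + k := by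
  rw [← mul_inv_eq_one, ← expU_neg, ← expU_add, expU_eq_one_iff]
  refine exists_congr fun k => ?_
  constructor <;> intro h <;> linarith

/-- A continuous real function which is integer-valued is constant on a connected space. -/
theorem eq_of_expU_eq_one {A : Type*} [TopologicalSpace A] [PreconnectedSpace A] {f : A → ℝ}
    (hf : Continuous f) (h : ∀ a, expU (f a) = 1) (a b : A) : f a = f b := by
  choose k hk using fun a => expU_eq_one_iff.1 (h a)
  have hc : Continuous k := by
    rw [Int.isClosedEmbedding_coe_real.isInducing.continuous_iff]
    exact hf.congr hk
  rw [hk, hk, PreconnectedSpace.constant ‹_› hc]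

section

variable {E : Type*} [NormedAddCommGroup E] [NormedSpace ℝ E] {H : Type*} [TopologicalSpace H]
  {I : ModelWithCorners ℝ E H} {M : Type*} [TopologicalSpace M] [ChartedSpace H M]

/-- Continuous lifts along `ℝ → U(1)` of smooth maps are smooth. -/
theorem contMDiffAt_of_expU {f : M → ℝ} {x : M} (hf : ContinuousAt f x)
    (h : ContMDiffAt I (𝓡 1) ∞ (fun y => expU (f y)) x) : ContMDiffAt I 𝓘(ℝ, ℝ) ∞ f x := by
  have h1 : ContMDiffAt I 𝓘(ℝ, ℝ) ∞ (fun y => f x + circleLog (expU (f y) * expU (-f x))) x := by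
    refine contMDiffAt_const.add (ContMDiffAt.comp x (contMDiffAt_circleLog ?_)
      (h.mul contMDiffAt_const))
    rw [← expU_add, add_neg_cancel, expU_zero]
    simp
  refine h1.congr_of_eventuallyEq ?_
  have h2 : ∀ᶠ y in 𝓝 x, |f y - f x| < 1 / 2 := by
    have := Metric.tendsto_nhds.1 hf (1 / 2) (by norm_num)
    simpa [Real.dist_eq] using this
  filter_upwards [h2] with y hy
  rw [← expU_add, ← sub_eq_add_neg, circleLog_expU hy]
  ring

end

/-! ### Functions on the torus: winding number and logarithm -/

/-- The quotient map `ℝⁿ → 𝕋ⁿ`. -/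
noncomputable def torusExp {n : ℕ} (y : Fin n → ℝ) : Torus n := fun i => expU (y i)

/-- The componentwise principal logarithm, a (discontinuous) section of `torusExp`. -/
noncomputable def torusLog {n : ℕ} (c : Torus n) : Fin n → ℝ := fun i => circleLog (c i)

/-- The algebra `C^∞(𝕋ⁿ, ℝ)`. -/
abbrev TorusReal (n : ℕ) : Type := C^∞⟮torusModel n, Torus n; 𝓘(ℝ, ℝ), ℝ⟯

variable {n : ℕ}

theorem torusExp_torusLog (c : Torus n) : torusExp (torusLog c) = c :=
  funext fun i => expU_circleLog (c i)

theorem torusExp_zero : torusExp (0 : Fin n → ℝ) = 1 := funext fun _ => expU_zero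

theorem torusExp_add (y z : Fin n → ℝ) : torusExp (y + z) = torusExp y * torusExp z :=
  funext fun _ => expU_add _ _

theorem torusExp_int (k : Fin n → ℤ) : torusExp (fun i => (k i : ℝ)) = 1 :=
  funext fun _ => expU_intCast _

theorem torusExp_eq_iff {y z : Fin n → ℝ} :
    torusExp y = torusExp z ↔ ∃ k : Fin n → ℤ, y = z + fun i => (k i : ℝ) := by
  refine ⟨fun h => ?_, fun ⟨k, hk⟩ => ?_⟩
  · choose k hk using fun i => expU_eq_iff.1 (congrFun h i)
    exact ⟨k, funext hk⟩
  · rw [hk, torusExp_add, torusExp_int, mul_one]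

theorem contMDiff_torusExp :
    ContMDiff 𝓘(ℝ, Fin n → ℝ) (torusModel n) ∞ (torusExp : (Fin n → ℝ) → Torus n) := fun _ =>
  contMDiffWithinAt_torus.2 fun i => (contMDiff_expU.comp
    (ContinuousLinearMap.proj (R := ℝ) (φ := fun _ : Fin n => ℝ) i).contDiff.contMDiff) _

theorem character_torusExp (m : Fin n → ℤ) (y : Fin n → ℝ) :
    character m (torusExp y) = expU (dotProduct (fun i => (m i : ℝ)) y) := by
  change ∏ i, expU (y i) ^ m i = _
  simp only [dotProduct, expU_sum, expU_zsmul]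

theorem character_apply_one (m : Fin n → ℤ) : character m (1 : Torus n) = 1 := by
  rw [← torusExp_zero, character_torusExp, dotProduct_zero, expU_zero]

theorem character_apply_mul (m : Fin n → ℤ) (c c' : Torus n) :
    character m (c * c') = character m c * character m c' := by
  change ∏ i, (c i * c' i) ^ m i = (∏ i, c i ^ m i) * ∏ i, c' i ^ m i
  simp only [mul_zpow, Finset.prod_mul_distrib]

theorem torusSub_eq (c : Torus n) (a : Fin n → ℝ) : torusSub c a = c * torusExp (-a) := rfl

/-- `m` and `ρ` are the winding number and the logarithm of `τ ∈ C^∞(𝕋ⁿ, U(1))`: written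
additively, `τ(c) = τ(0) + m · c + ρ(c)` where `ρ` is real-valued and `ρ(0) = 0`. -/
structure IsLogOf (τ : TorusFun n) (m : Fin n → ℤ) (ρ : Torus n → ℝ) : Prop where
  continuous : Continuous ρ
  map_one : ρ 1 = 0
  eq : ∀ c, τ c = τ 1 * character m c * expU (ρ c)

/-- A real function on the torus has no winding, so that `m` and `ρ` can be read off from the
lift of `τ` to `ℝⁿ`. -/
theorem IsLogOf.unique {τ : TorusFun n} {m m' : Fin n → ℤ} {ρ ρ' : Torus n → ℝ}
    (h : IsLogOf τ m ρ) (h' : IsLogOf τ m' ρ') : m = m' ∧ ρ = ρ' := by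
  let δ : (Fin n → ℝ) → ℝ := fun y => ρ (torusExp y) - ρ' (torusExp y) +
    dotProduct (fun i => (m i : ℝ)) y - dotProduct (fun i => (m' i : ℝ)) y
  have hδc : Continuous δ := by
    have h1 := h.continuous.comp contMDiff_torusExp.continuous
    have h2 := h'.continuous.comp contMDiff_torusExp.continuous
    simp only [Function.comp_def] at h1 h2
    have h3 : ∀ m : Fin n → ℤ, Continuous fun y : Fin n → ℝ =>
        dotProduct (fun i => (m i : ℝ)) y := fun m => by
      unfold dotProduct
      fun_prop
    exact ((h1.sub h2).add (h3 m)).sub (h3 m')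
  have hδ : ∀ y, expU (δ y) = 1 := fun y => by
    have := (h.eq (torusExp y)).symm.trans (h'.eq (torusExp y))
    rw [mul_assoc, mul_assoc, mul_right_inj, character_torusExp, character_torusExp, ← expU_add,
      ← expU_add] at this
    rw [show δ y = (dotProduct (fun i => (m i : ℝ)) y + ρ (torusExp y)) +
      -(dotProduct (fun i => (m' i : ℝ)) y + ρ' (torusExp y)) by simp only [δ]; ring,
      expU_add, expU_neg, this, mul_inv_cancel]
  have hδ0 : ∀ y, δ y = 0 := fun y => by
    rw [eq_of_expU_eq_one hδc hδ y 0]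
    simp [δ, torusExp_zero, h.map_one, h'.map_one]
  have hm : m = m' := by
    funext i
    have h1 := hδ0 (Pi.single i 1)
    have h2 : torusExp (Pi.single i 1 : Fin n → ℝ) = 1 := by
      rw [← torusExp_int (Pi.single i 1)]
      congr 1
      funext j
      by_cases hj : j = i
      · subst hj; simp
      · simp [Pi.single_eq_of_ne hj]
    simp only [δ, h2, h.map_one, h'.map_one, dotProduct_single, mul_one] at h1
    exact_mod_cast (show (m i : ℝ) = m' i by linarith)
  refine ⟨hm, funext fun c => ?_⟩
  have h1 := hδ0 (torusLog c)
  simp only [δ, torusExp_torusLog, hm] at h1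
  linarith

/-- Existence of the logarithm: the lift of `τ` along the universal coverings `ℝⁿ → 𝕋ⁿ` and
`ℝ → U(1)` is the sum of a constant, an integral linear form and a periodic function. -/
theorem exists_isLogOf (τ : TorusFun n) :
    ∃ (m : Fin n → ℤ) (ρ : TorusReal n), IsLogOf τ m ρ := by
  let f : C(Fin n → ℝ, Circle) := ⟨fun y => τ (torusExp y) * (τ 1)⁻¹,
    (τ.contMDiff.continuous.comp contMDiff_torusExp.continuous).mul continuous_const⟩
  obtain ⟨F, ⟨hF0, hF⟩, -⟩ := Circle.isCoveringMap_exp.existsUnique_continuousMap_lifts f 0 0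
    (by simp [f, torusExp_zero])
  let ℓ : (Fin n → ℝ) → ℝ := fun y => F y / (2 * Real.pi)
  have hℓc : Continuous ℓ := F.continuous.div_const _
  have hℓ0 : ℓ 0 = 0 := by simp [ℓ, hF0]
  have hℓ : ∀ y, expU (ℓ y) = τ (torusExp y) * (τ 1)⁻¹ := fun y => by
    rw [expU, mul_div_cancel₀ _ (by positivity)]
    exact congrFun hF y
  let ι : (Fin n → ℤ) → Fin n → ℝ := fun k i => k i
  have hι : ∀ k k', ι (k + k') = ι k + ι k' := fun k k' => funext fun i => by simp [ι]
  -- Translation by an integral vector `k` changes `ℓ` by a constant in `ℤ`, additively in `k`.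
  have hper : ∀ k y, ℓ (y + ι k) = ℓ y + ℓ (ι k) := fun k y => by
    have h1 := eq_of_expU_eq_one (f := fun y => ℓ (y + ι k) - ℓ y)
      ((hℓc.comp (continuous_id.add continuous_const)).sub hℓc) (fun y => by
        rw [sub_eq_add_neg, expU_add, expU_neg, hℓ, hℓ, torusExp_add, torusExp_int, mul_one,
          mul_inv_cancel]) y 0
    simp only [zero_add, hℓ0, sub_zero] at h1
    linarith
  let A : (Fin n → ℤ) →+ ℝ :=
    { toFun := fun k => ℓ (ι k)
      map_zero' := by rw [show ι 0 = 0 from funext fun i => by simp [ι], hℓ0]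
      map_add' := fun k k' => by rw [hι, hper] }
  have hint : ∀ k, ∃ m : ℤ, A k = m := fun k => expU_eq_one_iff.1 (by
    change expU (ℓ (ι k)) = 1
    rw [hℓ, torusExp_int, mul_inv_cancel])
  choose m hm using fun i => hint (fun j => if i = j then 1 else 0)
  have hA : ∀ k, A k = dotProduct (fun i => (m i : ℝ)) (ι k) := fun k => by
    have := A.toIntLinearMap.pi_apply_eq_sum_univ k
    simp only [AddMonoidHom.coe_toIntLinearMap, hm] at this
    rw [this, dotProduct]
    exact Finset.sum_congr rfl fun i _ => by simp [ι, mul_comm]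
  -- Subtracting the linear form with these values leaves a periodic function.
  let L : (Fin n → ℝ) → ℝ := fun y => ℓ y - dotProduct (fun i => (m i : ℝ)) y
  have hL : ∀ y z, torusExp y = torusExp z → L y = L z := fun y z h => by
    obtain ⟨k, rfl⟩ := torusExp_eq_iff.1 h
    change ℓ (z + ι k) - _ = _
    have := hA k
    change ℓ (ι k) = _ at this
    rw [hper, this, dotProduct_add]
    simp only [L, ι]
    ring
  have hLs : ContMDiff 𝓘(ℝ, Fin n → ℝ) 𝓘(ℝ, ℝ) ∞ L := by
    have h1 : ContMDiff 𝓘(ℝ, Fin n → ℝ) 𝓘(ℝ, ℝ) ∞ ℓ := fun y =>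
      contMDiffAt_of_expU hℓc.continuousAt (by
        simp only [hℓ]
        exact ((τ.contMDiff.comp contMDiff_torusExp).mul contMDiff_const) y)
    refine h1.sub (ContDiff.contMDiff ?_)
    unfold dotProduct
    fun_prop
  -- Near `torusExp y₀`, a smooth section of `torusExp` is `c ↦ y₀ + log (c / torusExp y₀)`.
  have hρ : ContMDiff (torusModel n) 𝓘(ℝ, ℝ) ∞ fun c : Torus n => L (torusLog c) := fun c₀ => by
    have h1 : (fun c : Torus n => L (torusLog c)) =
        fun c => L (fun i => torusLog c₀ i + circleLog (c i * (c₀ i)⁻¹)) := funext fun c =>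
      hL _ _ (by
        rw [torusExp_torusLog]
        funext i
        change c i = expU (_ + _)
        rw [expU_add, expU_circleLog, torusLog, expU_circleLog, mul_comm, inv_mul_cancel_right])
    rw [h1]
    refine hLs.contMDiffAt.comp c₀ (contMDiffAt_pi_space.2 fun i => ?_)
    refine contMDiffAt_const.add (ContMDiffAt.comp c₀ (contMDiffAt_circleLog ?_)
      ((contMDiff_torus_apply i).contMDiffAt.mul contMDiffAt_const))
    simp
  refine ⟨m, ⟨fun c => L (torusLog c), hρ⟩, hρ.continuous, ?_, fun c => ?_⟩
  · change L (torusLog 1) = 0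
    rw [hL (torusLog 1) 0 (by rw [torusExp_torusLog, torusExp_zero])]
    simp [L, hℓ0]
  · change _ = _ * _ * expU (L (torusLog c))
    have h1 := character_torusExp m (torusLog c)
    rw [torusExp_torusLog] at h1
    rw [h1, mul_assoc, ← expU_add]
    simp only [L]
    rw [add_sub_cancel, hℓ, torusExp_torusLog, mul_comm, inv_mul_cancel_right]

/-- The winding number `m ∈ ℤⁿ` of a function `𝕋ⁿ → U(1)`. -/
noncomputable def winding (τ : TorusFun n) : Fin n → ℤ := (exists_isLogOf τ).choose

/-- The real function `ρ` with `ρ(0) = 0` and `τ(c) = τ(0) + m · c + ρ(c)`, where `m` is the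
winding number of `τ`. -/
noncomputable def logPart (τ : TorusFun n) : TorusReal n := (exists_isLogOf τ).choose_spec.choose

theorem isLogOf (τ : TorusFun n) : IsLogOf τ (winding τ) (logPart τ) :=
  (exists_isLogOf τ).choose_spec.choose_spec

theorem IsLogOf.winding_eq {τ : TorusFun n} {m : Fin n → ℤ} {ρ : Torus n → ℝ}
    (h : IsLogOf τ m ρ) : winding τ = m := ((isLogOf τ).unique h).1

theorem IsLogOf.logPart_apply {τ : TorusFun n} {m : Fin n → ℤ} {ρ : Torus n → ℝ}
    (h : IsLogOf τ m ρ) (c : Torus n) : logPart τ c = ρ c := congrFun ((isLogOf τ).unique h).2 c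

/-! ### Algebraic rules for winding numbers and logarithms -/

theorem torusFun_eq (τ : TorusFun n) (c : Torus n) :
    τ c = τ 1 * character (winding τ) c * expU (logPart τ c) := (isLogOf τ).eq c

theorem logPart_apply_one (τ : TorusFun n) : logPart τ 1 = 0 := (isLogOf τ).map_one

theorem isLogOf_mul (τ σ : TorusFun n) :
    IsLogOf (τ * σ) (winding τ + winding σ) (logPart τ + logPart σ : TorusReal n) where
  continuous := (logPart τ + logPart σ).contMDiff.continuous
  map_one := by
    change logPart τ 1 + logPart σ 1 = 0
    rw [logPart_apply_one, logPart_apply_one, add_zero]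
  eq c := by
    change τ c * σ c = τ 1 * σ 1 * character (winding τ + winding σ) c *
      expU (logPart τ c + logPart σ c)
    rw [torusFun_eq τ c, torusFun_eq σ c, character_add, expU_add]
    change _ = _ * (character _ c * character _ c) * _
    ac_rfl

theorem isLogOf_translate (a : Fin n → ℝ) (τ : TorusFun n) :
    IsLogOf (translate a τ) (winding τ)
      fun c => logPart τ (torusSub c a) - logPart τ (torusSub 1 a) where
  continuous := ((logPart τ).contMDiff.continuous.comp (contMDiff_torusSub a).continuous).sub
    continuous_const
  map_one := sub_self _
  eq c := by
    change τ (torusSub c a) = τ (torusSub 1 a) * _ * _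
    rw [torusFun_eq τ (torusSub c a), torusFun_eq τ (torusSub 1 a), torusSub_eq, torusSub_eq,
      character_apply_mul, character_apply_mul, character_apply_one, sub_eq_add_neg, expU_add,
      expU_neg, one_mul]
    simp only [mul_assoc, mul_right_inj]
    rw [mul_left_comm (character (winding τ) c), mul_right_inj, mul_left_comm,
      mul_left_comm (expU (logPart τ (1 * torusExp (-a)))), mul_inv_cancel, mul_one]

theorem isLogOf_constFun_mul_character (s : Circle) (m : Fin n → ℤ) :
    IsLogOf (constFun n s * character m) m (0 : TorusReal n) where
  continuous := (0 : TorusReal n).contMDiff.continuous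
  map_one := rfl
  eq c := by
    change s * character m c = s * character m 1 * _ * expU 0
    rw [character_apply_one, expU_zero, mul_one, mul_one]

theorem winding_mul (τ σ : TorusFun n) : winding (τ * σ) = winding τ + winding σ :=
  (isLogOf_mul τ σ).winding_eq

theorem logPart_mul (τ σ : TorusFun n) : logPart (τ * σ) = logPart τ + logPart σ :=
  ContMDiffMap.ext (isLogOf_mul τ σ).logPart_apply

theorem winding_translate (a : Fin n → ℝ) (τ : TorusFun n) :
    winding (translate a τ) = winding τ := (isLogOf_translate a τ).winding_eq

theorem winding_constFun_mul_character (s : Circle) (m : Fin n → ℤ) :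
    winding (constFun n s * character m) = m := (isLogOf_constFun_mul_character s m).winding_eq

theorem logPart_constFun_mul_character (s : Circle) (m : Fin n → ℤ) :
    logPart (constFun n s * character m) = 0 :=
  ContMDiffMap.ext (isLogOf_constFun_mul_character s m).logPart_apply

theorem constFun_one_mul_character_zero : constFun n 1 * character (0 : Fin n → ℤ) = 1 := by
  rw [constFun_one, character_one, one_mul]

theorem winding_one : winding (1 : TorusFun n) = 0 := by
  rw [← constFun_one_mul_character_zero, winding_constFun_mul_character]

theorem logPart_one : logPart (1 : TorusFun n) = 0 := by
  rw [← constFun_one_mul_character_zero, logPart_constFun_mul_character]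

theorem logPart_inv (τ : TorusFun n) : logPart τ⁻¹ = -logPart τ := by
  rw [eq_neg_iff_add_eq_zero, ← logPart_mul, inv_mul_cancel, logPart_one]

/-- The translate `c ↦ ρ(c - a)` of a real function on the torus. -/
noncomputable def translateReal (a : Fin n → ℝ) : TorusReal n →ₗ[ℝ] TorusReal n where
  toFun ρ := ⟨fun c => ρ (torusSub c a), ρ.contMDiff.comp (contMDiff_torusSub a)⟩
  map_add' _ _ := rfl
  map_smul' _ _ := rfl

/-- The constant functions on the torus. -/
noncomputable def constReal (n : ℕ) : ℝ →ₗ[ℝ] TorusReal n where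
  toFun r := ⟨fun _ => r, contMDiff_const⟩
  map_add' _ _ := rfl
  map_smul' _ _ := rfl

/-- Evaluation of real functions at a point of the torus. -/
noncomputable def evalReal (c : Torus n) : TorusReal n →ₗ[ℝ] ℝ where
  toFun ρ := ρ c
  map_add' _ _ := rfl
  map_smul' _ _ := rfl

theorem logPart_translate (a : Fin n → ℝ) (τ : TorusFun n) :
    logPart (translate a τ) = translateReal a (logPart τ) -
      constReal n (evalReal 1 (translateReal a (logPart τ))) :=
  ContMDiffMap.ext (isLogOf_translate a τ).logPart_apply

/-- The reduction mod `ℤ` of a real function on the torus. -/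
noncomputable def expReal (ρ : TorusReal n) : TorusFun n :=
  ⟨fun c => expU (ρ c), contMDiff_expU.comp ρ.contMDiff⟩

theorem expReal_zero : expReal (0 : TorusReal n) = 1 := ContMDiffMap.ext fun _ => expU_zero

theorem expReal_add (ρ σ : TorusReal n) : expReal (ρ + σ) = expReal ρ * expReal σ :=
  ContMDiffMap.ext fun _ => expU_add _ _

theorem expReal_neg (ρ : TorusReal n) : expReal (-ρ) = (expReal ρ)⁻¹ :=
  ContMDiffMap.ext fun _ => expU_neg _

theorem expReal_sub (ρ σ : TorusReal n) : expReal (ρ - σ) = expReal ρ * (expReal σ)⁻¹ := by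
  rw [sub_eq_add_neg, expReal_add, expReal_neg]

theorem translate_expReal (a : Fin n → ℝ) (ρ : TorusReal n) :
    translate a (expReal ρ) = expReal (translateReal a ρ) := rfl

theorem expReal_constReal (r : ℝ) : expReal (constReal n r) = constFun n (expU r) := rfl

/-- The decomposition of `τ` as an equation in `C^∞(𝕋ⁿ, U(1))`. -/
theorem torusFun_eq_mul (τ : TorusFun n) :
    τ = constFun n (τ 1) * character (winding τ) * expReal (logPart τ) :=
  ContMDiffMap.ext (torusFun_eq τ)

/-! ### Smooth families of functions on the torus -/

section

variable {d : ℕ} {X : Type*} [TopologicalSpace X] [ChartedSpace (EuclideanSpace ℝ (Fin d)) X]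
  [IsManifold (𝓡 d) ∞ X] {U : Opens X} {f : X → TorusFun n}

theorem contMDiffAt_torusFun (hf : SmoothOn d f U) {x : X} (hx : x ∈ U) (c : Torus n) :
    ContMDiffAt ((𝓡 d).prod (torusModel n)) (𝓡 1) ∞ (fun p : X × Torus n => f p.1 p.2) (x, c) :=
  ContMDiffOn.contMDiffAt hf ((U.isOpen.prod isOpen_univ).mem_nhds ⟨hx, trivial⟩)

/-- By compactness of the torus, nearby members of a smooth family of maps `𝕋ⁿ → U(1)` differ by
a map to the domain of the logarithm of `U(1)`; so their winding numbers agree and the difference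
of their logarithms is explicit. -/
theorem eventually_isLogOf (hf : SmoothOn d f U) {x : X} (hx : x ∈ U) :
    ∀ᶠ y in 𝓝 x, IsLogOf (f y) (winding (f x)) fun c => logPart (f x) c +
      circleLog (f y c * (f x c)⁻¹) - circleLog (f y 1 * (f x 1)⁻¹) := by
  have h1 : ∀ᶠ y in 𝓝 x, ∀ c ∈ (univ : Set (Torus n)),
      ((f y c * (f x c)⁻¹ : Circle) : ℂ) ∈ Complex.slitPlane := by
    refine isCompact_univ.eventually_forall_of_forall_eventually fun c _ => ?_
    have h2 : ContinuousAt (fun p : X × Torus n => f p.1 p.2 * (f x p.2)⁻¹) (x, c) :=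
      (contMDiffAt_torusFun hf hx c).continuousAt.mul
        (((f x).contMDiff.continuous.comp continuous_snd).continuousAt.inv)
    have h3 : Continuous fun z : Circle => (z : ℂ) := continuous_subtype_val
    have h4 : ContinuousAt (fun p : X × Torus n => ((f p.1 p.2 * (f x p.2)⁻¹ : Circle) : ℂ))
        (x, c) := ContinuousAt.comp (g := fun z : Circle => (z : ℂ)) h3.continuousAt h2
    exact h4.eventually (Complex.isOpen_slitPlane.mem_nhds (by simp))
  filter_upwards [h1] with y hy
  refine ⟨?_, ?_, fun c => ?_⟩
  · have h2 : ContMDiff (torusModel n) 𝓘(ℝ, ℝ) ∞ fun c => circleLog (f y c * (f x c)⁻¹) :=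
      fun c => ContMDiffAt.comp c (contMDiffAt_circleLog (hy c trivial))
        ((f y).contMDiff.mul (f x).contMDiff.inv).contMDiffAt
    exact ((logPart (f x)).contMDiff.continuous.add h2.continuous).sub continuous_const
  · rw [logPart_apply_one, zero_add, sub_self]
  · rw [sub_eq_add_neg, expU_add, expU_add, expU_neg, expU_circleLog, expU_circleLog]
    calc f y c = f x 1 * character (winding (f x)) c * expU (logPart (f x) c) *
          (f y c * (f x c)⁻¹) := by
          rw [← torusFun_eq (f x) c, mul_comm, inv_mul_cancel_right]
      _ = _ := by
          rw [mul_inv_rev, inv_inv, eq_comm, ← div_eq_mul_inv (f x 1), ← mul_div_assoc,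
            ← mul_div_assoc, div_eq_iff_eq_mul]
          ac_rfl

theorem smoothOn_winding (hf : SmoothOn d f U) :
    SmoothOn d (fun x => Multiplicative.ofAdd (winding (f x))) U := fun x hx => by
  filter_upwards [eventually_isLogOf hf hx] with y hy
  rw [hy.winding_eq]

theorem contMDiffAt_logPart (hf : SmoothOn d f U) {x : X} (hx : x ∈ U) (c : Torus n) :
    ContMDiffAt ((𝓡 d).prod (torusModel n)) 𝓘(ℝ, ℝ) ∞
      (fun p : X × Torus n => logPart (f p.1) p.2) (x, c) := by
  have hU := eventually_isLogOf hf hx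
  have h0 : ∀ c : Torus n, ((f x c * (f x c)⁻¹ : Circle) : ℂ) ∈ Complex.slitPlane := by simp
  have h1 : ContMDiffAt ((𝓡 d).prod (torusModel n)) 𝓘(ℝ, ℝ) ∞
      (fun p : X × Torus n => circleLog (f p.1 p.2 * (f x p.2)⁻¹)) (x, c) :=
    ContMDiffAt.comp (x, c) (contMDiffAt_circleLog (h0 c))
      ((contMDiffAt_torusFun hf hx c).mul ((f x).contMDiff.comp contMDiff_snd).inv.contMDiffAt)
  have h2 : ContMDiffAt ((𝓡 d).prod (torusModel n)) 𝓘(ℝ, ℝ) ∞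
      (fun p : X × Torus n => circleLog (f p.1 1 * (f x 1)⁻¹)) (x, c) := by
    refine ContMDiffAt.comp (x, c) (contMDiffAt_circleLog (h0 1)) (ContMDiffAt.mul ?_
      contMDiffAt_const)
    exact ContMDiffAt.comp (x, c) (g := fun p : X × Torus n => f p.1 p.2)
      (f := fun p : X × Torus n => (p.1, (1 : Torus n))) (contMDiffAt_torusFun hf hx 1)
      (contMDiffAt_fst.prodMk contMDiffAt_const)
  refine ((((logPart (f x)).contMDiff.comp contMDiff_snd).contMDiffAt.add h1).sub
    h2).congr_of_eventuallyEq ?_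
  filter_upwards [continuousAt_fst.eventually hU] with p hp
  exact hp.logPart_apply p.2

/-- Evaluation at the unit of the torus is smooth in families. -/
theorem smoothOn_eval_one (hf : SmoothOn d f U) : SmoothOn d (fun x => f x 1) U := fun x hx =>
  (ContMDiffAt.comp x (g := fun p : X × Torus n => f p.1 p.2)
    (f := fun x : X => (x, (1 : Torus n))) (contMDiffAt_torusFun hf hx 1)
    (contMDiffAt_id.prodMk contMDiffAt_const)).contMDiffWithinAt

theorem smoothOn_expReal {ρ : X → TorusReal n} (hρ : ∀ x ∈ U, ∀ c,
    ContMDiffAt ((𝓡 d).prod (torusModel n)) 𝓘(ℝ, ℝ) ∞ (fun p : X × Torus n => ρ p.1 p.2) (x, c)) :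
    SmoothOn d (fun x => expReal (ρ x)) U := fun p hp =>
  (contMDiff_expU.contMDiffAt.comp p (hρ p.1 hp.1 p.2)).contMDiffWithinAt

end

/-! ### Averaging with a smooth partition of unity -/

section

variable {ι : Type*} {d : ℕ} {X : Type*} [TopologicalSpace X]
  [ChartedSpace (EuclideanSpace ℝ (Fin d)) X]
  {V : Type*} [AddCommGroup V] [Module ℝ V] {W : Type*} [AddCommGroup W] [Module ℝ W]

/-- The average `∑ₚ ψₚ(x) Fₚ` of a family of vectors at a point `x`. -/
noncomputable def partitionSum (ψ : SmoothPartitionOfUnity ι (𝓡 d) X) (x : X) :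
    (ι → V) →ₗ[ℝ] V :=
  ∑ p ∈ ψ.finsupport x, ψ p x • LinearMap.proj p

variable {ψ : SmoothPartitionOfUnity ι (𝓡 d) X}

theorem partitionSum_apply (x : X) (F : ι → V) :
    partitionSum ψ x F = ∑ p ∈ ψ.finsupport x, ψ p x • F p := by
  simp [partitionSum]

theorem map_partitionSum (L : V →ₗ[ℝ] W) (x : X) (F : ι → V) :
    L (partitionSum ψ x F) = partitionSum ψ x fun p => L (F p) := by
  simp [partitionSum_apply]

theorem partitionSum_const (x : X) (v : V) : partitionSum ψ x (fun _ => v) = v := by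
  rw [partitionSum_apply, ← Finset.sum_smul, ψ.sum_finsupport x (mem_univ x), one_smul]

/-- Only the members of the cover that contain `x` contribute to the average at `x`. -/
theorem partitionSum_congr {U : ι → Set X} (hψ : ψ.IsSubordinate U) {x : X} {F G : ι → V}
    (h : ∀ p, x ∈ U p → F p = G p) : partitionSum ψ x F = partitionSum ψ x G := by
  rw [partitionSum_apply, partitionSum_apply]
  refine Finset.sum_congr rfl fun p hp => ?_
  rw [h p (hψ p (subset_tsupport _ ((ψ.mem_finsupport x).1 hp)))]

theorem contMDiffAt_partitionSum {E : Type*} [NormedAddCommGroup E] [NormedSpace ℝ E]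
    {E' : Type*} [NormedAddCommGroup E'] [NormedSpace ℝ E'] {H : Type*} [TopologicalSpace H]
    {I : ModelWithCorners ℝ E' H} {N : Type*} [TopologicalSpace N] [ChartedSpace H N]
    {U : ι → Set X} (hψ : ψ.IsSubordinate U) {q : N → X} {y : N}
    (hq : ContMDiffAt I (𝓡 d) ∞ q y) {F : ι → N → E}
    (hF : ∀ p, q y ∈ U p → ContMDiffAt I 𝓘(ℝ, E) ∞ (F p) y) :
    ContMDiffAt I 𝓘(ℝ, E) ∞ (fun z => partitionSum ψ (q z) fun p => F p z) y := by
  have h1 : ContMDiffAt I 𝓘(ℝ, E) ∞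
      (fun z => ∑ p ∈ ψ.fintsupport (q y), ψ p (q z) • F p z) y :=
    contMDiffAt_finsetSum fun p hp => ((ψ p).contMDiff.contMDiffAt.comp y hq).smul
      (hF p (hψ p ((ψ.mem_fintsupport_iff (q y) p).1 hp)))
  refine h1.congr_of_eventuallyEq ?_
  filter_upwards [hq.continuousAt.eventually (ψ.eventually_finsupport_subset (q y))] with z hz
  rw [partitionSum_apply]
  refine Finset.sum_subset hz fun p _ hp => ?_
  rw [ψ.mem_finsupport, Function.notMem_support] at hp
  rw [hp, zero_smul]

end

theorem exists_partition {d : ℕ} {X : Type*} [TopologicalSpace X] [T2Space X]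
    [SecondCountableTopology X] [ChartedSpace (EuclideanSpace ℝ (Fin d)) X]
    [IsManifold (𝓡 d) ∞ X] (𝒰 : OpenCover X) :
    ∃ ψ : SmoothPartitionOfUnity 𝒰.ι (𝓡 d) X, ψ.IsSubordinate fun i => (𝒰.U i : Set X) := by
  have := ChartedSpace.locallyCompactSpace (EuclideanSpace ℝ (Fin d)) X
  refine SmoothPartitionOfUnity.exists_isSubordinate (𝓡 d) isClosed_univ _
    (fun i => (𝒰.U i).isOpen) fun x _ => ?_
  obtain ⟨i, hi⟩ := 𝒰.exists_mem x
  exact mem_iUnion.2 ⟨i, hi⟩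

/-! ### Integral vectors and affine functions on the torus -/

/-- The inclusion `ℤⁿ → ℝⁿ`, written additively. -/
def realVec (m : Fin n → ℤ) : Fin n → ℝ := fun i => (m i : ℝ)

theorem realVec_zero : realVec (0 : Fin n → ℤ) = 0 := funext fun _ => Int.cast_zero

theorem realVec_add (m m' : Fin n → ℤ) : realVec (m + m') = realVec m + realVec m' :=
  funext fun _ => Int.cast_add _ _

theorem smoothOn_realVec {d : ℕ} {X : Type*} [TopologicalSpace X]
    [ChartedSpace (EuclideanSpace ℝ (Fin d)) X] [IsManifold (𝓡 d) ∞ X] {U : Opens X}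
    {m : X → Fin n → ℤ} (hm : SmoothOn d m U) : SmoothOn d (fun x => realVec (m x)) U :=
  smooth_intToReal n d X m U hm

theorem translate_affine (a : Fin n → ℝ) (s : Circle) (m : Fin n → ℤ) :
    translate a (constFun n s * character m) =
      constFun n (s * expU (-dotProduct (realVec m) a)) * character m := by
  rw [translate_mul, translate_constFun, translate_character, constFun_mul, mul_assoc,
    mul_comm (character m), dotProduct_comm (realVec m)]
  rfl

theorem constFun_inv (s : Circle) : constFun n s⁻¹ = (constFun n s)⁻¹ := rfl

theorem affine_mul (s s' : Circle) (m m' : Fin n → ℤ) :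
    constFun n s * character m * (constFun n s' * character m') =
      constFun n (s * s') * character (m + m') := by
  rw [constFun_mul, character_add, mul_mul_mul_comm]

theorem affine_injective {s s' : Circle} {m m' : Fin n → ℤ}
    (h : constFun n s * character m = constFun n s' * character m') : s = s' ∧ m = m' := by
  refine ⟨?_, ?_⟩
  · have := congrArg (fun τ : TorusFun n => τ 1) h
    change s * character m 1 = s' * character m' 1 at this
    simpa [character_apply_one] using this
  · rw [← winding_constFun_mul_character s m, h, winding_constFun_mul_character]

/-- A function without logarithmic part is affine. -/
theorem eq_affine {τ : TorusFun n} (h : logPart τ = 0) :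
    τ = constFun n (τ 1) * character (winding τ) := by
  conv_lhs => rw [torusFun_eq_mul τ, h, expReal_zero, mul_one]

/-! ### Cocycles for the two 2-groups in components -/

section

universe u

variable {d : ℕ} {X : Type u} [TopologicalSpace X] [ChartedSpace (EuclideanSpace ℝ (Fin d)) X]
  [IsManifold (𝓡 d) ∞ X] {𝒰 : OpenCover X}

namespace TBF2R

/-- The component `a_ij` of a `𝕋𝔹^R_{F2}`-cocycle `(a, (τ, m))`. -/
def shift (c : Cocycle d (TBF2R.{u} n) 𝒰) (i j : 𝒰.ι) (x : X) : Fin n → ℝ := c.g i j x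

/-- The component `τ_ijk` of a `𝕋𝔹^R_{F2}`-cocycle `(a, (τ, m))`. -/
def fn (c : Cocycle d (TBF2R.{u} n) 𝒰) (i j k : 𝒰.ι) (x : X) : TorusFun n :=
  Prod.fst (α := TorusFun n) (β := Multiplicative (Fin n → ℤ)) (c.a i j k x)

/-- The component `m_ijk` of a `𝕋𝔹^R_{F2}`-cocycle `(a, (τ, m))`. -/
def int (c : Cocycle d (TBF2R.{u} n) 𝒰) (i j k : 𝒰.ι) (x : X) : Fin n → ℤ :=
  Prod.snd (α := TorusFun n) (β := Multiplicative (Fin n → ℤ)) (c.a i j k x)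

section

variable (c : Cocycle d (TBF2R.{u} n) 𝒰)

theorem smoothOn_shift (i j : 𝒰.ι) : SmoothOn d (shift c i j) (𝒰.U i ⊓ 𝒰.U j) := c.smooth_g i j

theorem smoothOn_fn (i j k : 𝒰.ι) : SmoothOn d (fn c i j k) (𝒰.U i ⊓ 𝒰.U j ⊓ 𝒰.U k) :=
  And.left (b := SmoothOn d (int c i j k) (𝒰.U i ⊓ 𝒰.U j ⊓ 𝒰.U k)) (c.smooth_a i j k)

theorem smoothOn_int (i j k : 𝒰.ι) : SmoothOn d (int c i j k) (𝒰.U i ⊓ 𝒰.U j ⊓ 𝒰.U k) :=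
  And.right (a := SmoothOn d (fn c i j k) (𝒰.U i ⊓ 𝒰.U j ⊓ 𝒰.U k)) (c.smooth_a i j k)

variable {x : X} {i j k l : 𝒰.ι}

theorem shift_self (hi : x ∈ 𝒰.U i) : shift c i i x = 0 := c.g_self i x hi

theorem fn_left (hi : x ∈ 𝒰.U i) (hj : x ∈ 𝒰.U j) : fn c i i j x = 1 :=
  congrArg Prod.fst (c.a_left i j x ⟨hi, hj⟩)

theorem fn_right (hi : x ∈ 𝒰.U i) (hj : x ∈ 𝒰.U j) : fn c i j j x = 1 :=
  congrArg Prod.fst (c.a_right i j x ⟨hi, hj⟩)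

theorem int_left (hi : x ∈ 𝒰.U i) (hj : x ∈ 𝒰.U j) : int c i i j x = 0 :=
  congrArg Prod.snd (c.a_left i j x ⟨hi, hj⟩)

theorem int_right (hi : x ∈ 𝒰.U i) (hj : x ∈ 𝒰.U j) : int c i j j x = 0 :=
  congrArg Prod.snd (c.a_right i j x ⟨hi, hj⟩)

theorem shift_eq (hi : x ∈ 𝒰.U i) (hj : x ∈ 𝒰.U j) (hk : x ∈ 𝒰.U k) :
    realVec (int c i j k x) + shift c j k x + shift c i j x = shift c i k x :=
  c.t_a i j k x ⟨⟨hi, hj⟩, hk⟩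

theorem fn_cocycle (hi : x ∈ 𝒰.U i) (hj : x ∈ 𝒰.U j) (hk : x ∈ 𝒰.U k) (hl : x ∈ 𝒰.U l) :
    fn c i k l x * translate (shift c k l x) (fn c i j k x) = fn c i j l x * fn c j k l x :=
  congrArg Prod.fst (c.cocycle i j k l x ⟨⟨⟨hi, hj⟩, hk⟩, hl⟩)

theorem int_cocycle (hi : x ∈ 𝒰.U i) (hj : x ∈ 𝒰.U j) (hk : x ∈ 𝒰.U k) (hl : x ∈ 𝒰.U l) :
    int c i k l x + int c i j k x = int c i j l x + int c j k l x :=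
  congrArg Prod.snd (c.cocycle i j k l x ⟨⟨⟨hi, hj⟩, hk⟩, hl⟩)

end

theorem equivalent_iff {c c' : Cocycle d (TBF2R.{u} n) 𝒰} : c.Equivalent c' ↔
    ∃ (h : 𝒰.ι → X → Fin n → ℝ) (e : 𝒰.ι → 𝒰.ι → X → TorusFun n)
      (m : 𝒰.ι → 𝒰.ι → X → Fin n → ℤ),
      (∀ i, SmoothOn d (h i) (𝒰.U i)) ∧
      (∀ i j, SmoothOn d (e i j) (𝒰.U i ⊓ 𝒰.U j)) ∧
      (∀ i j, SmoothOn d (m i j) (𝒰.U i ⊓ 𝒰.U j)) ∧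
      (∀ i, ∀ x ∈ 𝒰.U i, e i i x = 1 ∧ m i i x = 0) ∧
      (∀ i j, ∀ x ∈ 𝒰.U i ⊓ 𝒰.U j,
        realVec (m i j x) + h j x + shift c i j x = shift c' i j x + h i x) ∧
      (∀ i j k, ∀ x ∈ 𝒰.U i ⊓ 𝒰.U j ⊓ 𝒰.U k,
        fn c' i j k x * translate (shift c' j k x) (e i j x) * e j k x =
            e i k x * translate (h k x) (fn c i j k x) ∧
          int c' i j k x + m i j x + m j k x = m i k x + int c i j k x) := by
  constructor
  · rintro ⟨h, e, h1, h2, h3, h4, h5⟩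
    exact ⟨h, fun i j x => Prod.fst (α := TorusFun n) (β := Multiplicative (Fin n → ℤ)) (e i j x),
      fun i j x => Prod.snd (α := TorusFun n) (β := Multiplicative (Fin n → ℤ)) (e i j x), h1,
      fun i j => (h2 i j).1, fun i j => (h2 i j).2,
      fun i x hx => ⟨congrArg Prod.fst (h3 i x hx), congrArg Prod.snd (h3 i x hx)⟩, h4,
      fun i j k x hx => ⟨congrArg Prod.fst (h5 i j k x hx), congrArg Prod.snd (h5 i j k x hx)⟩⟩
  · rintro ⟨h, e, m, h1, h2, h2', h3, h4, h5⟩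
    exact ⟨h, fun i j x => ((e i j x, m i j x) : TorusFun n × Multiplicative (Fin n → ℤ)), h1,
      fun i j => ⟨h2 i j, h2' i j⟩, fun i x hx => Prod.ext (h3 i x hx).1 (h3 i x hx).2, h4,
      fun i j k x hx => Prod.ext (h5 i j k x hx).1 (h5 i j k x hx).2⟩

end TBF2R

namespace TD

/-- The component `a_ij` of a `𝕋𝔻`-cocycle `(a ⊕ â, (m ⊕ m̂, t))`. -/
def shift (c : Cocycle d (TD.{u} n) 𝒰) (i j : 𝒰.ι) (x : X) : Fin n → ℝ :=
  Prod.fst (α := Multiplicative (Fin n → ℝ)) (β := Multiplicative (Fin n → ℝ)) (c.g i j x)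

/-- The component `â_ij` of a `𝕋𝔻`-cocycle `(a ⊕ â, (m ⊕ m̂, t))`. -/
def dualShift (c : Cocycle d (TD.{u} n) 𝒰) (i j : 𝒰.ι) (x : X) : Fin n → ℝ :=
  Prod.snd (α := Multiplicative (Fin n → ℝ)) (β := Multiplicative (Fin n → ℝ)) (c.g i j x)

/-- The component `m_ijk` of a `𝕋𝔻`-cocycle `(a ⊕ â, (m ⊕ m̂, t))`. -/
def int (c : Cocycle d (TD.{u} n) 𝒰) (i j k : 𝒰.ι) (x : X) : Fin n → ℤ :=
  Prod.fst (Prod.fst (α := Multiplicative (Fin n → ℤ) × Multiplicative (Fin n → ℤ)) (β := Circle)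
    (c.a i j k x))

/-- The component `m̂_ijk` of a `𝕋𝔻`-cocycle `(a ⊕ â, (m ⊕ m̂, t))`. -/
def dualInt (c : Cocycle d (TD.{u} n) 𝒰) (i j k : 𝒰.ι) (x : X) : Fin n → ℤ :=
  Prod.snd (Prod.fst (α := Multiplicative (Fin n → ℤ) × Multiplicative (Fin n → ℤ)) (β := Circle)
    (c.a i j k x))

/-- The component `t_ijk` of a `𝕋𝔻`-cocycle `(a ⊕ â, (m ⊕ m̂, t))`. -/
def phase (c : Cocycle d (TD.{u} n) 𝒰) (i j k : 𝒰.ι) (x : X) : Circle :=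
  Prod.snd (α := Multiplicative (Fin n → ℤ) × Multiplicative (Fin n → ℤ)) (β := Circle)
    (c.a i j k x)

section

variable (c : Cocycle d (TD.{u} n) 𝒰)

theorem smoothOn_shift (i j : 𝒰.ι) : SmoothOn d (shift c i j) (𝒰.U i ⊓ 𝒰.U j) :=
  And.left (b := SmoothOn d (dualShift c i j) (𝒰.U i ⊓ 𝒰.U j)) (c.smooth_g i j)

theorem smoothOn_dualShift (i j : 𝒰.ι) : SmoothOn d (dualShift c i j) (𝒰.U i ⊓ 𝒰.U j) :=
  And.right (a := SmoothOn d (shift c i j) (𝒰.U i ⊓ 𝒰.U j)) (c.smooth_g i j)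

variable {x : X} {i j k l : 𝒰.ι}

theorem shift_eq (hi : x ∈ 𝒰.U i) (hj : x ∈ 𝒰.U j) (hk : x ∈ 𝒰.U k) :
    realVec (int c i j k x) + shift c j k x + shift c i j x = shift c i k x :=
  congrArg Prod.fst (c.t_a i j k x ⟨⟨hi, hj⟩, hk⟩)

theorem dualShift_eq (hi : x ∈ 𝒰.U i) (hj : x ∈ 𝒰.U j) (hk : x ∈ 𝒰.U k) :
    realVec (dualInt c i j k x) + dualShift c j k x + dualShift c i j x = dualShift c i k x :=
  congrArg Prod.snd (c.t_a i j k x ⟨⟨hi, hj⟩, hk⟩)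

end

/-- Sufficient conditions for an equivalence of `𝕋𝔻`-cocycles. The condition on the integral
components of the 2-cells is implied by the one on the real components. -/
theorem equivalent_of {c c' : Cocycle d (TD.{u} n) 𝒰}
    (h h' : 𝒰.ι → X → Fin n → ℝ) (m m' : 𝒰.ι → 𝒰.ι → X → Fin n → ℤ)
    (v : 𝒰.ι → 𝒰.ι → X → Circle)
    (smooth_h : ∀ i, SmoothOn d (h i) (𝒰.U i)) (smooth_h' : ∀ i, SmoothOn d (h' i) (𝒰.U i))
    (smooth_m : ∀ i j, SmoothOn d (m i j) (𝒰.U i ⊓ 𝒰.U j))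
    (smooth_m' : ∀ i j, SmoothOn d (m' i j) (𝒰.U i ⊓ 𝒰.U j))
    (smooth_v : ∀ i j, SmoothOn d (v i j) (𝒰.U i ⊓ 𝒰.U j))
    (self : ∀ i, ∀ x ∈ 𝒰.U i, m i i x = 0 ∧ m' i i x = 0 ∧ v i i x = 1)
    (shift_eq : ∀ i j, ∀ x ∈ 𝒰.U i ⊓ 𝒰.U j,
      realVec (m i j x) + h j x + shift c i j x = shift c' i j x + h i x)
    (dualShift_eq : ∀ i j, ∀ x ∈ 𝒰.U i ⊓ 𝒰.U j,
      realVec (m' i j x) + h' j x + dualShift c i j x = dualShift c' i j x + h' i x)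
    (int_eq : ∀ i j k, ∀ x ∈ 𝒰.U i ⊓ 𝒰.U j ⊓ 𝒰.U k,
      int c' i j k x + m i j x + m j k x = m i k x + int c i j k x)
    (dualInt_eq : ∀ i j k, ∀ x ∈ 𝒰.U i ⊓ 𝒰.U j ⊓ 𝒰.U k,
      dualInt c' i j k x + m' i j x + m' j k x = m' i k x + dualInt c i j k x)
    (phase_eq : ∀ i j k, ∀ x ∈ 𝒰.U i ⊓ 𝒰.U j ⊓ 𝒰.U k,
      phase c' i j k x * (v i j x * expU (-dotProduct (dualShift c' j k x) (realVec (m i j x)))) *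
        v j k x = v i k x * (phase c i j k x *
          expU (-dotProduct (h' k x) (realVec (int c i j k x))))) : c.Equivalent c' :=
  ⟨fun i x => ((h i x, h' i x) : Multiplicative (Fin n → ℝ) × Multiplicative (Fin n → ℝ)),
    fun i j x => (((m i j x, m' i j x), v i j x) :
      (Multiplicative (Fin n → ℤ) × Multiplicative (Fin n → ℤ)) × Circle),
    fun i => ⟨smooth_h i, smooth_h' i⟩,
    fun i j => ⟨⟨smooth_m i j, smooth_m' i j⟩, smooth_v i j⟩,
    fun i x hx => Prod.ext (Prod.ext (self i x hx).1 (self i x hx).2.1) (self i x hx).2.2,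
    fun i j x hx => Prod.ext (shift_eq i j x hx) (dualShift_eq i j x hx),
    fun i j k x hx => Prod.ext (Prod.ext (int_eq i j k x hx) (dualInt_eq i j k x hx))
      (phase_eq i j k x hx)⟩

theorem shift_mapCocycle (c : Cocycle d (TD.{u} n) 𝒰) (i j : 𝒰.ι) (x : X) :
    TBF2R.shift ((leftLeg n).mapCocycle c) i j x = shift c i j x := rfl

theorem int_mapCocycle (c : Cocycle d (TD.{u} n) 𝒰) (i j k : 𝒰.ι) (x : X) :
    TBF2R.int ((leftLeg n).mapCocycle c) i j k x = int c i j k x :=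
  show -0 + int c i j k x + -0 = int c i j k x by simp

theorem fn_mapCocycle (c : Cocycle d (TD.{u} n) 𝒰) (i j k : 𝒰.ι) (x : X) :
    TBF2R.fn ((leftLeg n).mapCocycle c) i j k x = constFun n (phase c i j k x *
      expU (-(dotProduct (realVec (dualInt c i j k x)) (shift c j k x + shift c i j x) +
        dotProduct (dualShift c j k x) (shift c i j x)))) * character (dualInt c i j k x) := by
  change (constFun n (expU (dotProduct (realVec (dualInt c i j k x))
    (shift c j k x + shift c i j x))))⁻¹ * (constFun n (phase c i j k x) *
      character (dualInt c i j k x)) * (constFun n (expU (dotProduct (dualShift c j k x)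
        (shift c i j x))))⁻¹ = _
  rw [neg_add, expU_add, constFun_mul, constFun_mul, expU_neg, expU_neg]
  rw [constFun_inv, constFun_inv]
  ac_rfl

end TD

end

/-! ### Removing the logarithmic parts -/

section

universe u

variable {d : ℕ} {X : Type u} [TopologicalSpace X] [ChartedSpace (EuclideanSpace ℝ (Fin d)) X]
  {𝒰 : OpenCover X}

/-- The negative of the average of the logarithmic parts of a family of maps `𝕋ⁿ → U(1)`. -/
noncomputable def logAverage (ψ : SmoothPartitionOfUnity 𝒰.ι (𝓡 d) X)
    (f : 𝒰.ι → X → TorusFun n) (x : X) : TorusReal n :=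
  -partitionSum ψ x fun p => logPart (f p x)

variable {ψ : SmoothPartitionOfUnity 𝒰.ι (𝓡 d) X}

theorem smoothOn_expReal_logAverage [IsManifold (𝓡 d) ∞ X]
    (hψ : ψ.IsSubordinate fun i => (𝒰.U i : Set X))
    {f : 𝒰.ι → X → TorusFun n} {U : Opens X} (hf : ∀ p, SmoothOn d (f p) (𝒰.U p ⊓ U)) :
    SmoothOn d (fun x => expReal (logAverage ψ f x)) U := by
  refine smoothOn_expReal fun x hx c => ?_
  have h1 : (fun p : X × Torus n => logAverage ψ f p.1 p.2) = fun p =>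
      -partitionSum ψ p.1 fun q => logPart (f q p.1) p.2 := funext fun p =>
    congrArg Neg.neg (map_partitionSum (evalReal p.2) p.1 fun q => logPart (f q p.1))
  rw [h1]
  exact (contMDiffAt_partitionSum (N := X × Torus n) (q := Prod.fst)
    (F := fun q p => logPart (f q p.1) p.2) hψ contMDiffAt_fst
    fun q hq => contMDiffAt_logPart (hf q) ⟨hq, hx⟩ c).neg

theorem logAverage_eq_zero (hψ : ψ.IsSubordinate fun i => (𝒰.U i : Set X))
    {f : 𝒰.ι → X → TorusFun n} {x : X} (hf : ∀ p, x ∈ 𝒰.U p → f p x = 1) :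
    logAverage ψ f x = 0 := by
  rw [logAverage, partitionSum_congr hψ (G := fun _ => 0) fun p hp => by rw [hf p hp, logPart_one],
    partitionSum_const, neg_zero]

/-- If the logarithmic part of `τ` is the twisted coboundary `ρ''ₚ + ρ'ₚ(· - a) - ρₚ`, up to
constants, for every `p`, where `ρₚ`, `ρ'ₚ`, `ρ''ₚ` are the logarithmic parts of the members of
three families, then it is removed by the averages over `p`. -/
theorem logPart_eq_zero_of_average (hψ : ψ.IsSubordinate fun i => (𝒰.U i : Set X))
    {f f' f'' : 𝒰.ι → X → TorusFun n} {x : X} {τ : TorusFun n} {a : Fin n → ℝ}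
    (h : ∀ p, x ∈ 𝒰.U p → logPart (f'' p x) + logPart (translate a (f' p x)) =
      logPart (f p x) + logPart τ) :
    logPart (τ * translate a (expReal (logAverage ψ f' x)) * expReal (logAverage ψ f'' x) *
      (expReal (logAverage ψ f x))⁻¹) = 0 := by
  let r : 𝒰.ι → ℝ := fun p => evalReal 1 (translateReal a (logPart (f' p x)))
  have h1 : (partitionSum ψ x fun p => logPart (f'' p x)) +
      (translateReal a (partitionSum ψ x fun p => logPart (f' p x)) -
        constReal n (partitionSum ψ x r)) =
      (partitionSum ψ x fun p => logPart (f p x)) + logPart τ := by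
    rw [map_partitionSum, map_partitionSum, ← map_sub, ← map_add,
      ← partitionSum_const (ψ := ψ) x (logPart τ), ← map_add]
    refine partitionSum_congr hψ fun p hp => ?_
    have := h p hp
    rw [logPart_translate] at this
    exact this
  have h2 : translateReal a (logAverage ψ f' x) + logAverage ψ f'' x - logAverage ψ f x =
      -logPart τ - constReal n (partitionSum ψ x r) := by
    simp only [logAverage, map_neg]
    rw [← sub_eq_zero] at h1 ⊢
    rw [← neg_eq_zero, ← h1]
    abel
  rw [translate_expReal, mul_assoc, mul_assoc, ← mul_assoc (expReal (translateReal a _)),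
    ← expReal_add, ← expReal_sub, h2, expReal_sub, expReal_neg]
  rw [← mul_assoc, mul_inv_eq_of_eq_mul (torusFun_eq_mul τ), expReal_constReal, ← constFun_inv,
    mul_comm, ← mul_assoc, ← constFun_mul, logPart_constFun_mul_character]

/-- The contributions of a 1-cochain to the cocycle condition of a twisted 2-cocycle cancel. -/
theorem twist_cocycle {A : Type*} [AddCommGroup A] {a b c e p q r s v w : A}
    (h : a + b = c + e) : a + p + q + -r + (b + s + v + -p) =
      c + s + w + -r + (e + v + q + -w) := by
  rw [← sub_eq_zero] at h ⊢
  rw [← h]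
  abel

theorem translate_inv (a : Fin n → ℝ) (τ : TorusFun n) : translate a τ⁻¹ = (translate a τ)⁻¹ :=
  rfl

variable [IsManifold (𝓡 d) ∞ X]

namespace TBF2R

theorem translate_translate_shift (c : Cocycle d (TBF2R.{u} n) 𝒰) {x : X} {i j k : 𝒰.ι}
    (hi : x ∈ 𝒰.U i) (hj : x ∈ 𝒰.U j) (hk : x ∈ 𝒰.U k) (τ : TorusFun n) :
    translate (shift c j k x) (translate (shift c i j x) τ) = translate (shift c i k x) τ := by
  rw [← shift_eq c hi hj hk, add_assoc, translate_add (realVec _), translate_add]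
  exact (translate_int (n := n) (int c i j k x) _).symm

/-- The cocycle obtained from `c` by changing the 2-cells by the twisted coboundary of `e`. -/
noncomputable def twist (c : Cocycle d (TBF2R.{u} n) 𝒰) (e : 𝒰.ι → 𝒰.ι → X → TorusFun n)
    (smooth_e : ∀ i j, SmoothOn d (e i j) (𝒰.U i ⊓ 𝒰.U j))
    (e_self : ∀ i, ∀ x ∈ 𝒰.U i, e i i x = 1) : Cocycle d (TBF2R.{u} n) 𝒰 where
  g := c.g
  a i j k x := ((fn c i j k x * translate (shift c j k x) (e i j x) * e j k x * (e i k x)⁻¹,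
    int c i j k x) : TorusFun n × Multiplicative (Fin n → ℤ))
  smooth_g := c.smooth_g
  smooth_a i j k := by
    have hij : 𝒰.U i ⊓ 𝒰.U j ⊓ 𝒰.U k ≤ 𝒰.U i ⊓ 𝒰.U j := inf_le_left
    have hjk : 𝒰.U i ⊓ 𝒰.U j ⊓ 𝒰.U k ≤ 𝒰.U j ⊓ 𝒰.U k := inf_le_inf_right _ inf_le_right
    have hik : 𝒰.U i ⊓ 𝒰.U j ⊓ 𝒰.U k ≤ 𝒰.U i ⊓ 𝒰.U k := inf_le_inf_right _ inf_le_left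
    exact And.intro (smoothOn_mul (smoothOn_mul (smoothOn_mul (smoothOn_fn c i j k)
      (smoothOn_translate ((smoothOn_shift c j k).mono hjk) ((smooth_e i j).mono hij)))
      ((smooth_e j k).mono hjk)) (smoothOn_inv ((smooth_e i k).mono hik))) (smoothOn_int c i j k)
  g_self := c.g_self
  a_left i j x hx := by
    refine Prod.ext ?_ (int_left c hx.1 hx.2)
    change fn c i i j x * translate _ (e i i x) * e i j x * (e i j x)⁻¹ = 1
    rw [fn_left c hx.1 hx.2, e_self i x hx.1, mul_inv_cancel_right, one_mul]
    rfl
  a_right i j x hx := by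
    refine Prod.ext ?_ (int_right c hx.1 hx.2)
    change fn c i j j x * translate (shift c j j x) (e i j x) * e j j x * (e i j x)⁻¹ = 1
    rw [fn_right c hx.1 hx.2, e_self j x hx.2, shift_self c hx.2, translate_zero, one_mul, mul_one,
      mul_inv_cancel]
  t_a := c.t_a
  cocycle i j k l x hx := by
    obtain ⟨⟨⟨hi, hj⟩, hk⟩, hl⟩ := hx
    refine Prod.ext ?_ (int_cocycle c hi hj hk hl)
    change fn c i k l x * translate (shift c k l x) (e i k x) * e k l x * (e i l x)⁻¹ *
        translate (shift c k l x) (fn c i j k x * translate (shift c j k x) (e i j x) *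
          e j k x * (e i k x)⁻¹) =
      fn c i j l x * translate (shift c j l x) (e i j x) * e j l x * (e i l x)⁻¹ *
        (fn c j k l x * translate (shift c k l x) (e j k x) * e k l x * (e j l x)⁻¹)
    simp only [translate_mul, translate_inv, translate_translate_shift c hj hk hl]
    exact twist_cocycle (A := Additive (TorusFun n)) (fn_cocycle c hi hj hk hl)

theorem twist_equivalent (c : Cocycle d (TBF2R.{u} n) 𝒰) (e : 𝒰.ι → 𝒰.ι → X → TorusFun n)
    (smooth_e : ∀ i j, SmoothOn d (e i j) (𝒰.U i ⊓ 𝒰.U j))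
    (e_self : ∀ i, ∀ x ∈ 𝒰.U i, e i i x = 1) : (twist c e smooth_e e_self).Equivalent c := by
  refine equivalent_iff.2 ⟨fun _ _ => 0, e, fun _ _ _ => 0, fun i => smoothOn_const d _ _,
    smooth_e, fun i j => smoothOn_const d _ _, fun i x hx => ⟨e_self i x hx, rfl⟩,
    fun i j x hx => ?_, fun i j k x hx => ⟨?_, ?_⟩⟩
  · rw [realVec_zero, zero_add, zero_add, add_zero]
    rfl
  · rw [translate_zero]
    change _ = e i k x * (fn c i j k x * translate (shift c j k x) (e i j x) * e j k x *
      (e i k x)⁻¹)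
    rw [mul_comm (e i k x), inv_mul_cancel_right]
  · rw [add_zero, add_zero, zero_add]
    rfl

/-- The sheaf of logarithmic parts is fine: every cocycle is equivalent to one whose 2-cells are
affine functions on the torus. -/
theorem exists_equivalent_affine (hψ : ψ.IsSubordinate fun i => (𝒰.U i : Set X))
    (c : Cocycle d (TBF2R.{u} n) 𝒰) : ∃ c' : Cocycle d (TBF2R.{u} n) 𝒰, c'.Equivalent c ∧
      ∀ i j k, ∀ x ∈ 𝒰.U i ⊓ 𝒰.U j ⊓ 𝒰.U k, logPart (fn c' i j k x) = 0 := by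
  let e : 𝒰.ι → 𝒰.ι → X → TorusFun n := fun i j x =>
    expReal (logAverage ψ (fun p => fn c p i j) x)
  have smooth_e : ∀ i j, SmoothOn d (e i j) (𝒰.U i ⊓ 𝒰.U j) := fun i j =>
    smoothOn_expReal_logAverage hψ fun p => (smoothOn_fn c p i j).mono (inf_assoc _ _ _).ge
  have e_self : ∀ i, ∀ x ∈ 𝒰.U i, e i i x = 1 := fun i x hx => by
    simp only [e]
    rw [logAverage_eq_zero hψ fun p hp => fn_right c hp hx, expReal_zero]
  refine ⟨twist c e smooth_e e_self, twist_equivalent c e smooth_e e_self, ?_⟩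
  rintro i j k x ⟨⟨hi, hj⟩, hk⟩
  refine logPart_eq_zero_of_average hψ fun p hp => ?_
  rw [← logPart_mul, ← logPart_mul]
  exact congrArg logPart (fn_cocycle c hp hi hj hk)

/-- The contributions of a 0-cochain to the condition on an equivalence cancel. -/
theorem twist_equivalence {A : Type*} [AddCommGroup A] {f f' p q r s t u : A}
    (h : f' + p + q = r + f) :
    f' + (p + s + -t) + (q + u + -s) = r + u + -t + f := by
  rw [← sub_eq_zero] at h ⊢
  rw [← h]
  abel

/-- Equivalences between affine cocycles may be chosen to be affine. -/
theorem exists_affine_equivalence (hψ : ψ.IsSubordinate fun i => (𝒰.U i : Set X))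
    {c c' : Cocycle d (TBF2R.{u} n) 𝒰}
    (hc : ∀ i j k, ∀ x ∈ 𝒰.U i ⊓ 𝒰.U j ⊓ 𝒰.U k, logPart (fn c i j k x) = 0)
    (hc' : ∀ i j k, ∀ x ∈ 𝒰.U i ⊓ 𝒰.U j ⊓ 𝒰.U k, logPart (fn c' i j k x) = 0)
    (H : c.Equivalent c') :
    ∃ (h : 𝒰.ι → X → Fin n → ℝ) (e : 𝒰.ι → 𝒰.ι → X → TorusFun n)
      (m : 𝒰.ι → 𝒰.ι → X → Fin n → ℤ),
      (∀ i, SmoothOn d (h i) (𝒰.U i)) ∧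
      (∀ i j, SmoothOn d (e i j) (𝒰.U i ⊓ 𝒰.U j)) ∧
      (∀ i j, SmoothOn d (m i j) (𝒰.U i ⊓ 𝒰.U j)) ∧
      (∀ i, ∀ x ∈ 𝒰.U i, e i i x = 1 ∧ m i i x = 0) ∧
      (∀ i j, ∀ x ∈ 𝒰.U i ⊓ 𝒰.U j,
        realVec (m i j x) + h j x + shift c i j x = shift c' i j x + h i x) ∧
      (∀ i j k, ∀ x ∈ 𝒰.U i ⊓ 𝒰.U j ⊓ 𝒰.U k,
        fn c' i j k x * translate (shift c' j k x) (e i j x) * e j k x =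
            e i k x * translate (h k x) (fn c i j k x) ∧
          int c' i j k x + m i j x + m j k x = m i k x + int c i j k x) ∧
      ∀ i j, ∀ x ∈ 𝒰.U i ⊓ 𝒰.U j, logPart (e i j x) = 0 := by
  obtain ⟨h, e, m, h1, h2, h3, h4, h5, h6⟩ := equivalent_iff.1 H
  let κ : 𝒰.ι → X → TorusFun n := fun i x => expReal (logAverage ψ (fun p => e p i) x)
  have smooth_κ : ∀ i, SmoothOn d (κ i) (𝒰.U i) := fun i =>
    smoothOn_expReal_logAverage hψ fun p => h2 p i
  refine ⟨h, fun i j x => e i j x * κ j x * (translate (shift c' i j x) (κ i x))⁻¹, m, h1,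
    fun i j => smoothOn_mul (smoothOn_mul (h2 i j) ((smooth_κ j).mono inf_le_right))
      (smoothOn_inv (smoothOn_translate (smoothOn_shift c' i j) ((smooth_κ i).mono inf_le_left))),
    h3, fun i x hx => ⟨?_, (h4 i x hx).2⟩, h5, ?_, ?_⟩
  · beta_reduce
    rw [(h4 i x hx).1, shift_self c' hx, translate_zero, one_mul, mul_inv_cancel]
  · rintro i j k x ⟨⟨hi, hj⟩, hk⟩
    refine ⟨?_, (h6 i j k x ⟨⟨hi, hj⟩, hk⟩).2⟩
    simp only [translate_mul, translate_inv, translate_translate_shift c' hi hj hk]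
    exact twist_equivalence (A := Additive (TorusFun n)) (h6 i j k x ⟨⟨hi, hj⟩, hk⟩).1
  · rintro i j x ⟨hi, hj⟩
    -- `e i j` enters through its inverse: this gives the coboundary the required signs, and the
    -- trivial family takes the place of `f''`.
    have h7 := logPart_eq_zero_of_average hψ (f := fun p => e p j) (f' := fun p => e p i)
      (f'' := fun _ _ => 1) (x := x) (τ := (e i j x)⁻¹) (a := shift c' i j x) fun p hp => by
        have h8 := congrArg logPart (h6 p i j x ⟨⟨hp, hi⟩, hj⟩).1
        simp only [logPart_mul, hc' p i j x ⟨⟨hp, hi⟩, hj⟩] at h8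
        rw [logPart_translate (h j x), hc p i j x ⟨⟨hp, hi⟩, hj⟩] at h8
        simp only [map_zero, sub_zero, zero_add, add_zero] at h8
        rw [logPart_one, zero_add, logPart_inv, ← h8, add_neg_cancel_right]
    rw [logAverage_eq_zero hψ (f := fun _ _ => 1) fun _ _ => rfl, expReal_zero, mul_one] at h7
    rw [← neg_eq_zero, ← logPart_inv, ← h7]
    congr 1
    simp only [κ, mul_inv_rev, inv_inv]
    rw [mul_comm ((expReal (logAverage ψ (fun p => e p j) x))⁻¹), ← mul_assoc, mul_comm (translate _ _)]

end TBF2R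

end

universe u

variable {d : ℕ} {X : Type u} [TopologicalSpace X] [ChartedSpace (EuclideanSpace ℝ (Fin d)) X]
  [IsManifold (𝓡 d) ∞ X] {𝒰 : OpenCover X} {ψ : SmoothPartitionOfUnity 𝒰.ι (𝓡 d) X}

/-! ### Affine cocycles lift to the T-duality 2-group -/

/-- An identity in `U(1)` follows from another one by comparing the real exponents mod `ℤ`. -/
theorem mul_expU_eq {z w : Circle} {r r' u u' : ℝ} (k : ℤ) (h : z * expU r = w * expU r')
    (hu : u + r' = r + u' + k) : z * expU u = w * expU u' := by
  rw [← mul_left_inj (expU r'), mul_assoc, ← expU_add, hu, expU_add, expU_add, expU_intCast,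
    mul_one, ← mul_assoc, h]
  ac_rfl

theorem realVec_dot (m m' : Fin n → ℤ) :
    dotProduct (realVec m) (realVec m') = ((dotProduct m m' : ℤ) : ℝ) := by
  simp [dotProduct, realVec]

/-- The phases `t = s + m̂ · (b + a) + b̂ · a` satisfy the cocycle condition of `𝕋𝔻` if the constant
terms `s` of the affine functions satisfy the one of `𝕋𝔹^R_{F2}`. The vectors `a, b, c`
belong to the edges of a path in a tetrahedron, the integral vectors to its triangles. -/
theorem phase_cocycle {s₁ s₂ s₃ s₄ : Circle} {a b c ba cb b' c' cb' : Fin n → ℝ}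
    {m₁ m₂ w₁ w₂ w₃ w₄ : Fin n → ℤ} (h₁ : realVec m₁ + b + a = ba) (h₂ : realVec m₂ + c + b = cb)
    (h₃ : realVec w₄ + c' + b' = cb') (hw : w₁ + w₂ = w₃ + w₄)
    (hs : s₁ * (s₂ * expU (-dotProduct (realVec w₂) c)) = s₃ * s₄) :
    s₁ * expU (dotProduct (realVec w₁) (c + ba) + dotProduct c' ba) *
        (s₂ * expU (dotProduct (realVec w₂) (b + a) + dotProduct b' a) *
          expU (-dotProduct c' (realVec m₁))) =
      s₃ * expU (dotProduct (realVec w₃) (cb + a) + dotProduct cb' a) *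
        (s₄ * expU (dotProduct (realVec w₄) (c + b) + dotProduct c' b)) := by
  have hw' : realVec w₁ = realVec w₃ + realVec w₄ - realVec w₂ := by
    rw [eq_sub_iff_add_eq, ← realVec_add, ← realVec_add, hw]
  have key := mul_expU_eq (z := s₁ * s₂) (w := s₃ * s₄)
    (r := -dotProduct (realVec w₂) c) (r' := 0)
    (u := dotProduct (realVec w₁) (c + ba) + dotProduct c' ba +
      (dotProduct (realVec w₂) (b + a) + dotProduct b' a) + -dotProduct c' (realVec m₁))
    (u' := dotProduct (realVec w₃) (cb + a) + dotProduct cb' a +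
      (dotProduct (realVec w₄) (c + b) + dotProduct c' b))
    (dotProduct w₁ m₁ - dotProduct w₃ m₂) (by rw [expU_zero, mul_one, ← hs, mul_assoc]) (by
      rw [Int.cast_sub, ← realVec_dot, ← realVec_dot, hw', ← h₁, ← h₂, ← h₃]
      simp only [add_dotProduct, dotProduct_add, sub_dotProduct]
      ring)
  rw [expU_add, expU_add, expU_add (_ + _) (_ + _)] at key
  calc _ = _ := by ac_rfl
    _ = _ := key
    _ = _ := by ac_rfl

/-- The phases `v = u - a₁' · h₀ + w · (h₁ + a) + h₁' · a` satisfy the condition for equivalences of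
`𝕋𝔻`-cocycles if the constant terms `u` of the affine functions satisfy the one of
`𝕋𝔹^R_{F2}`. The two cocycles have edges `a, b, ba` and `a₁, b₁`, with dual components
`a', b', ba'` and `a₁', b₁', ba₁'`, and the vertices carry `h₀, h₁, h₂` and `h₀', h₁', h₂'`. -/
theorem phase_equivalence {t t₁ u v w : Circle} {a b ba a₁ b₁ a' b' ba' a₁' b₁' ba₁' : Fin n → ℝ}
    {h₀ h₁ h₂ h₀' h₁' h₂' : Fin n → ℝ} {m k l m' m₁' k' l' j' : Fin n → ℤ}
    (e : realVec m + b + a = ba) (e' : realVec m' + b' + a' = ba')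
    (ea : realVec k + h₁ + a = a₁ + h₀) (eb : realVec l + h₂ + b = b₁ + h₁)
    (ea' : realVec k' + h₁' + a' = a₁' + h₀') (eb' : realVec l' + h₂' + b' = b₁' + h₁')
    (eba' : realVec j' + h₂' + ba' = ba₁' + h₀') (em : m₁' + k' + l' = j' + m')
    (hs : t₁ * expU (-(dotProduct (realVec m₁') (b₁ + a₁) + dotProduct b₁' a₁)) *
        (u * expU (-dotProduct (realVec k') b₁)) * v =
      w * (t * expU (-(dotProduct (realVec m') (b + a) + dotProduct b' a)) *
        expU (-dotProduct (realVec m') h₂))) :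
    t₁ * (u * expU (-dotProduct a₁' h₀ + dotProduct (realVec k') (h₁ + a) + dotProduct h₁' a) *
          expU (-dotProduct b₁' (realVec k))) *
        (v * expU (-dotProduct b₁' h₁ + dotProduct (realVec l') (h₂ + b) + dotProduct h₂' b)) =
      w * expU (-dotProduct ba₁' h₀ + dotProduct (realVec j') (h₂ + ba) + dotProduct h₂' ba) *
        (t * expU (-dotProduct h₂' (realVec m))) := by
  have em' : realVec m₁' = realVec j' + realVec m' - realVec l' - realVec k' := by
    rw [eq_sub_iff_add_eq, eq_sub_iff_add_eq, ← realVec_add, ← realVec_add, ← realVec_add, em]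
  have key := mul_expU_eq (z := t₁ * u * v) (w := w * t)
    (r := -(dotProduct (realVec m₁') (b₁ + a₁) + dotProduct b₁' a₁) +
      -dotProduct (realVec k') b₁)
    (r' := -(dotProduct (realVec m') (b + a) + dotProduct b' a) + -dotProduct (realVec m') h₂)
    (u := -dotProduct a₁' h₀ + dotProduct (realVec k') (h₁ + a) + dotProduct h₁' a +
      -dotProduct b₁' (realVec k) +
      (-dotProduct b₁' h₁ + dotProduct (realVec l') (h₂ + b) + dotProduct h₂' b))
    (u' := -dotProduct ba₁' h₀ + dotProduct (realVec j') (h₂ + ba) + dotProduct h₂' ba +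
      -dotProduct h₂' (realVec m))
    (dotProduct j' (k + l - m) + dotProduct m' (k + l) - dotProduct k' k - dotProduct l' (k + l))
    (by
      rw [expU_add, expU_add]
      calc _ = _ := by ac_rfl
        _ = _ := hs
        _ = _ := by ac_rfl)
    (by
      simp only [dotProduct_add, dotProduct_sub, Int.cast_add, Int.cast_sub, ← realVec_dot]
      rw [em', eq_sub_of_add_eq ea.symm, eq_sub_of_add_eq eb.symm, eq_sub_of_add_eq ea'.symm,
        eq_sub_of_add_eq eb'.symm, eq_sub_of_add_eq eba'.symm, ← e, ← e']
      simp only [add_dotProduct, dotProduct_add, sub_dotProduct, dotProduct_sub]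
      ring)
  rw [expU_add _ (_ + _ + _), expU_add _ (-dotProduct b₁' (realVec k)),
    expU_add _ (-dotProduct h₂' (realVec m))] at key
  calc _ = _ := by ac_rfl
    _ = _ := key
    _ = _ := by ac_rfl

theorem TBF2R.winding_cocycle (c : Cocycle d (TBF2R.{u} n) 𝒰) {x : X} {i j k l : 𝒰.ι}
    (hi : x ∈ 𝒰.U i) (hj : x ∈ 𝒰.U j) (hk : x ∈ 𝒰.U k) (hl : x ∈ 𝒰.U l) :
    winding (fn c i k l x) + winding (fn c i j k x) =
      winding (fn c i j l x) + winding (fn c j k l x) := by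
  have := congrArg winding (fn_cocycle c hi hj hk hl)
  rwa [winding_mul, winding_mul, winding_translate] at this

theorem TBF2R.eval_cocycle (c : Cocycle d (TBF2R.{u} n) 𝒰)
    (hc : ∀ i j k, ∀ x ∈ 𝒰.U i ⊓ 𝒰.U j ⊓ 𝒰.U k, logPart (fn c i j k x) = 0) {x : X}
    {i j k l : 𝒰.ι} (hi : x ∈ 𝒰.U i) (hj : x ∈ 𝒰.U j) (hk : x ∈ 𝒰.U k) (hl : x ∈ 𝒰.U l) :
    fn c i k l x 1 * (fn c i j k x 1 *
        expU (-dotProduct (realVec (winding (fn c i j k x))) (shift c k l x))) =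
      fn c i j l x 1 * fn c j k l x 1 := by
  have := fn_cocycle c hi hj hk hl
  rw [eq_affine (hc i k l x ⟨⟨hi, hk⟩, hl⟩), eq_affine (hc i j k x ⟨⟨hi, hj⟩, hk⟩),
    eq_affine (hc i j l x ⟨⟨hi, hj⟩, hl⟩), eq_affine (hc j k l x ⟨⟨hj, hk⟩, hl⟩),
    translate_affine, affine_mul, affine_mul] at this
  exact (affine_injective this).1

namespace TD

/-- The functions `â_ij = -∑ₚ ψₚ m̂_pij`, where `m̂` are the winding numbers of the 2-cells of a
`𝕋𝔹^R_{F2}`-cocycle. The `m̂` form an integral 2-cocycle, of which `â` is a real trivialization. -/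
noncomputable def windingAverage (ψ : SmoothPartitionOfUnity 𝒰.ι (𝓡 d) X)
    (c : Cocycle d (TBF2R.{u} n) 𝒰) (i j : 𝒰.ι) (x : X) : Fin n → ℝ :=
  -partitionSum ψ x fun p => realVec (winding (TBF2R.fn c p i j x))

theorem smoothOn_windingAverage (hψ : ψ.IsSubordinate fun i => (𝒰.U i : Set X))
    (c : Cocycle d (TBF2R.{u} n) 𝒰) (i j : 𝒰.ι) :
    SmoothOn d (windingAverage ψ c i j) (𝒰.U i ⊓ 𝒰.U j) := fun x hx =>
  (contMDiffAt_partitionSum hψ (q := id)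
    (F := fun p x => realVec (winding (TBF2R.fn c p i j x))) contMDiffAt_id fun p hp =>
      ContMDiffOn.contMDiffAt (smoothOn_realVec (smoothOn_winding (TBF2R.smoothOn_fn c p i j)))
        ((𝒰.U p ⊓ 𝒰.U i ⊓ 𝒰.U j).isOpen.mem_nhds
          ⟨⟨hp, hx.1⟩, hx.2⟩)).neg.contMDiffWithinAt

theorem windingAverage_self (hψ : ψ.IsSubordinate fun i => (𝒰.U i : Set X))
    (c : Cocycle d (TBF2R.{u} n) 𝒰) {x : X} {i : 𝒰.ι} (hi : x ∈ 𝒰.U i) :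
    windingAverage ψ c i i x = 0 := by
  rw [windingAverage, partitionSum_congr hψ (G := fun _ => 0) fun p hp => by
    rw [TBF2R.fn_right c hp hi, winding_one, realVec_zero], partitionSum_const, neg_zero]

theorem windingAverage_eq (hψ : ψ.IsSubordinate fun i => (𝒰.U i : Set X))
    (c : Cocycle d (TBF2R.{u} n) 𝒰) {x : X} {i j k : 𝒰.ι} (hi : x ∈ 𝒰.U i) (hj : x ∈ 𝒰.U j)
    (hk : x ∈ 𝒰.U k) :
    realVec (winding (TBF2R.fn c i j k x)) + windingAverage ψ c j k x + windingAverage ψ c i j x =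
      windingAverage ψ c i k x := by
  have h1 : (partitionSum ψ x fun p => realVec (winding (TBF2R.fn c p j k x))) +
      (partitionSum ψ x fun p => realVec (winding (TBF2R.fn c p i j x))) =
      (partitionSum ψ x fun p => realVec (winding (TBF2R.fn c p i k x))) +
        realVec (winding (TBF2R.fn c i j k x)) := by
    rw [← partitionSum_const (ψ := ψ) x (realVec (winding (TBF2R.fn c i j k x))), ← map_add,
      ← map_add]
    refine partitionSum_congr hψ fun p hp => ?_
    have := congrArg realVec (TBF2R.winding_cocycle c hp hi hj hk)
    rwa [realVec_add, realVec_add] at this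
  simp only [windingAverage]
  rw [← sub_eq_zero] at h1 ⊢
  rw [← neg_eq_zero, ← h1]
  abel

/-- A lift of an affine `𝕋𝔹^R_{F2}`-cocycle to the T-duality 2-group. -/
noncomputable def ofAffine (hψ : ψ.IsSubordinate fun i => (𝒰.U i : Set X))
    (c : Cocycle d (TBF2R.{u} n) 𝒰)
    (hc : ∀ i j k, ∀ x ∈ 𝒰.U i ⊓ 𝒰.U j ⊓ 𝒰.U k, logPart (TBF2R.fn c i j k x) = 0) :
    Cocycle d (TD.{u} n) 𝒰 where
  g i j x := ((TBF2R.shift c i j x, windingAverage ψ c i j x) :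
    Multiplicative (Fin n → ℝ) × Multiplicative (Fin n → ℝ))
  a i j k x := (((TBF2R.int c i j k x, winding (TBF2R.fn c i j k x)), TBF2R.fn c i j k x 1 *
      expU (dotProduct (realVec (winding (TBF2R.fn c i j k x)))
        (TBF2R.shift c j k x + TBF2R.shift c i j x) +
          dotProduct (windingAverage ψ c j k x) (TBF2R.shift c i j x))) :
    (Multiplicative (Fin n → ℤ) × Multiplicative (Fin n → ℤ)) × Circle)
  smooth_g i j := And.intro (TBF2R.smoothOn_shift c i j) (smoothOn_windingAverage hψ c i j)
  smooth_a i j k := by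
    have hij : 𝒰.U i ⊓ 𝒰.U j ⊓ 𝒰.U k ≤ 𝒰.U i ⊓ 𝒰.U j := inf_le_left
    have hjk : 𝒰.U i ⊓ 𝒰.U j ⊓ 𝒰.U k ≤ 𝒰.U j ⊓ 𝒰.U k := inf_le_inf_right _ inf_le_right
    have h1 := TBF2R.smoothOn_fn c i j k
    have h2 : SmoothOn d (fun x => TBF2R.shift c j k x + TBF2R.shift c i j x)
        (𝒰.U i ⊓ 𝒰.U j ⊓ 𝒰.U k) :=
      smoothOn_mul (G := Multiplicative (Fin n → ℝ)) ((TBF2R.smoothOn_shift c j k).mono hjk)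
        ((TBF2R.smoothOn_shift c i j).mono hij)
    refine And.intro (And.intro (TBF2R.smoothOn_int c i j k) (smoothOn_winding h1))
      (smoothOn_mul (smoothOn_eval_one h1) ?_)
    simp only [expU_add]
    exact smoothOn_mul (smoothOn_expU_dot (smoothOn_realVec (smoothOn_winding h1)) h2)
      (smoothOn_expU_dot ((smoothOn_windingAverage hψ c j k).mono hjk)
        ((TBF2R.smoothOn_shift c i j).mono hij))
  g_self i x hx := Prod.ext (TBF2R.shift_self c hx) (windingAverage_self hψ c hx)
  a_left i j x hx := by
    refine Prod.ext (Prod.ext (TBF2R.int_left c hx.1 hx.2) ?_) ?_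
    · change winding (TBF2R.fn c i i j x) = 0
      rw [TBF2R.fn_left c hx.1 hx.2, winding_one]
    · rw [TBF2R.fn_left c hx.1 hx.2, winding_one, realVec_zero, zero_dotProduct,
        TBF2R.shift_self c hx.1, dotProduct_zero, add_zero, expU_zero]
      exact mul_one _
  a_right i j x hx := by
    refine Prod.ext (Prod.ext (TBF2R.int_right c hx.1 hx.2) ?_) ?_
    · change winding (TBF2R.fn c i j j x) = 0
      rw [TBF2R.fn_right c hx.1 hx.2, winding_one]
    · rw [TBF2R.fn_right c hx.1 hx.2, winding_one, realVec_zero, zero_dotProduct,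
        windingAverage_self hψ c hx.2, zero_dotProduct, add_zero, expU_zero]
      exact mul_one _
  t_a i j k x hx := Prod.ext (TBF2R.shift_eq c hx.1.1 hx.1.2 hx.2)
    (windingAverage_eq hψ c hx.1.1 hx.1.2 hx.2)
  cocycle i j k l x hx := by
    obtain ⟨⟨⟨hi, hj⟩, hk⟩, hl⟩ := hx
    have hw := TBF2R.winding_cocycle c hi hj hk hl
    refine Prod.ext (Prod.ext (TBF2R.int_cocycle c hi hj hk hl) hw) ?_
    have e1 := TBF2R.shift_eq c hi hj hk
    have e2 := TBF2R.shift_eq c hj hk hl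
    have e3 := windingAverage_eq hψ c hj hk hl
    have e4 := TBF2R.eval_cocycle c hc hi hj hk hl
    exact phase_cocycle e1 e2 e3 hw e4

theorem mapCocycle_ofAffine_equivalent (hψ : ψ.IsSubordinate fun i => (𝒰.U i : Set X))
    (c : Cocycle d (TBF2R.{u} n) 𝒰)
    (hc : ∀ i j k, ∀ x ∈ 𝒰.U i ⊓ 𝒰.U j ⊓ 𝒰.U k, logPart (TBF2R.fn c i j k x) = 0) :
    ((leftLeg n).mapCocycle (ofAffine hψ c hc)).Equivalent c := by
  refine TBF2R.equivalent_iff.2 ⟨fun _ _ => 0, fun _ _ _ => 1, fun _ _ _ => 0,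
    fun i => smoothOn_const d _ _, fun i j => smoothOn_const d _ _, fun i j => smoothOn_const d _ _,
    fun i x hx => ⟨rfl, rfl⟩, fun i j x hx => ?_, fun i j k x hx => ⟨?_, ?_⟩⟩
  · rw [realVec_zero, zero_add, zero_add, add_zero]
    rfl
  · rw [translate_zero, one_mul, mul_one, fn_mapCocycle]
    change TBF2R.fn c i j k x * 1 = constFun n (_ * expU (_ + _) * expU (-(_ + _))) * _
    rw [mul_one, mul_assoc, ← expU_add]
    conv_lhs => rw [eq_affine (hc i j k x hx)]
    refine congrArg (fun s => constFun n s * character (winding (TBF2R.fn c i j k x))) ?_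
    exact ((congrArg _ ((congrArg expU (add_neg_cancel _)).trans expU_zero)).trans (mul_one _)).symm
  · rw [add_zero, add_zero, zero_add, int_mapCocycle]
    rfl

end TD

/-! ### Bijectivity -/

theorem TD.logPart_fn_mapCocycle (c : Cocycle d (TD.{u} n) 𝒰) (i j k : 𝒰.ι) (x : X) :
    logPart (TBF2R.fn ((leftLeg n).mapCocycle c) i j k x) = 0 := by
  rw [fn_mapCocycle, logPart_constFun_mul_character]

theorem TD.winding_fn_mapCocycle (c : Cocycle d (TD.{u} n) 𝒰) (i j k : 𝒰.ι) (x : X) :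
    winding (TBF2R.fn ((leftLeg n).mapCocycle c) i j k x) = dualInt c i j k x := by
  rw [fn_mapCocycle, winding_constFun_mul_character]

/-- Cocycles for the T-duality 2-group are equivalent if their left legs are. -/
theorem TD.equivalent_of_mapCocycle (hψ : ψ.IsSubordinate fun i => (𝒰.U i : Set X))
    {c c' : Cocycle d (TD.{u} n) 𝒰}
    (H : ((leftLeg n).mapCocycle c).Equivalent ((leftLeg n).mapCocycle c')) : c.Equivalent c' := by
  obtain ⟨h, e, m, h1, h2, h3, h4, h5, h6, h7⟩ := TBF2R.exists_affine_equivalence hψ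
    (fun i j k x _ => logPart_fn_mapCocycle c i j k x)
    (fun i j k x _ => logPart_fn_mapCocycle c' i j k x) H
  simp only [shift_mapCocycle, int_mapCocycle] at h5 h6
  have hw : ∀ i j k, ∀ x ∈ 𝒰.U i ⊓ 𝒰.U j ⊓ 𝒰.U k, dualInt c' i j k x + winding (e i j x) +
      winding (e j k x) = winding (e i k x) + dualInt c i j k x := fun i j k x hx => by
    have := congrArg winding (h6 i j k x hx).1
    simpa only [winding_mul, winding_translate, winding_fn_mapCocycle] using this
  have smooth_w : ∀ i j, SmoothOn d (fun x => winding (e i j x)) (𝒰.U i ⊓ 𝒰.U j) := fun i j =>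
    smoothOn_winding (h2 i j)
  -- `b i j = n̂_ij + â_ij - â'_ij` is a 1-cocycle, hence a coboundary.
  let b : 𝒰.ι → 𝒰.ι → X → Fin n → ℝ := fun i j x =>
    realVec (winding (e i j x)) + dualShift c i j x - dualShift c' i j x
  have smooth_b : ∀ i j, SmoothOn d (b i j) (𝒰.U i ⊓ 𝒰.U j) := fun i j => by
    have e1 : ContMDiffOn (𝓡 d) 𝓘(ℝ, Fin n → ℝ) ∞ (fun x => realVec (winding (e i j x)))
      (𝒰.U i ⊓ 𝒰.U j : Opens X) := smoothOn_realVec (smooth_w i j)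
    have e2 : ContMDiffOn (𝓡 d) 𝓘(ℝ, Fin n → ℝ) ∞ (dualShift c i j)
      (𝒰.U i ⊓ 𝒰.U j : Opens X) := smoothOn_dualShift c i j
    have e3 : ContMDiffOn (𝓡 d) 𝓘(ℝ, Fin n → ℝ) ∞ (dualShift c' i j)
      (𝒰.U i ⊓ 𝒰.U j : Opens X) := smoothOn_dualShift c' i j
    exact (e1.add e2).sub e3
  have b_cocycle : ∀ i j k, ∀ x ∈ 𝒰.U i ⊓ 𝒰.U j ⊓ 𝒰.U k, b i k x = b i j x + b j k x := by
    rintro i j k x ⟨⟨hi, hj⟩, hk⟩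
    have e1 := congrArg realVec (hw i j k x ⟨⟨hi, hj⟩, hk⟩)
    simp only [realVec_add] at e1
    simp only [b]
    rw [← dualShift_eq c hi hj hk, ← dualShift_eq c' hi hj hk]
    rw [← sub_eq_zero] at e1 ⊢
    rw [← neg_eq_zero, ← e1]
    abel
  let h' : 𝒰.ι → X → Fin n → ℝ := fun i x => partitionSum ψ x fun p => b i p x
  have h'_eq : ∀ i j, ∀ x ∈ 𝒰.U i ⊓ 𝒰.U j, h' i x = b i j x + h' j x := fun i j x hx => by
    rw [← partitionSum_const (ψ := ψ) x (b i j x), ← map_add]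
    exact partitionSum_congr hψ fun p hp => b_cocycle i j p x ⟨hx, hp⟩
  have smooth_h' : ∀ i, SmoothOn d (h' i) (𝒰.U i) := fun i x hx =>
    (contMDiffAt_partitionSum hψ (q := id) (F := fun p x => b i p x) contMDiffAt_id
      fun p hp => ContMDiffOn.contMDiffAt (smooth_b i p)
        ((𝒰.U i ⊓ 𝒰.U p).isOpen.mem_nhds ⟨hx, hp⟩)).contMDiffWithinAt
  have dual_eq : ∀ i j, ∀ x ∈ 𝒰.U i ⊓ 𝒰.U j,
      realVec (winding (e i j x)) + h' j x + dualShift c i j x = dualShift c' i j x + h' i x :=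
    fun i j x hx => by
      rw [h'_eq i j x hx]
      simp only [b]
      abel
  refine equivalent_of h h' m (fun i j x => winding (e i j x)) (fun i j x => e i j x 1 *
    expU (-dotProduct (dualShift c' i j x) (h i x) +
      dotProduct (realVec (winding (e i j x))) (h j x + shift c i j x) +
      dotProduct (h' j x) (shift c i j x))) h1 smooth_h' h3 smooth_w (fun i j => ?_)
      (fun i x hx => ⟨(h4 i x hx).2, ?_, ?_⟩) h5 dual_eq (fun i j k x hx => (h6 i j k x hx).2) hw
      fun i j k x hx => ?_
  · have hi := (h1 i).mono (inf_le_left : 𝒰.U i ⊓ 𝒰.U j ≤ 𝒰.U i)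
    have hj := (h1 j).mono (inf_le_right : 𝒰.U i ⊓ 𝒰.U j ≤ 𝒰.U j)
    have hj' := (smooth_h' j).mono (inf_le_right : 𝒰.U i ⊓ 𝒰.U j ≤ 𝒰.U j)
    have hs : SmoothOn d (fun x => h j x + shift c i j x) (𝒰.U i ⊓ 𝒰.U j) :=
      smoothOn_mul (G := Multiplicative (Fin n → ℝ)) hj (smoothOn_shift c i j)
    refine smoothOn_mul (smoothOn_eval_one (h2 i j)) ?_
    simp only [expU_add, expU_neg]
    exact smoothOn_mul (smoothOn_mul (smoothOn_inv (smoothOn_expU_dot (smoothOn_dualShift c' i j)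
      hi)) (smoothOn_expU_dot (smoothOn_realVec (smooth_w i j)) hs))
      (smoothOn_expU_dot hj' (smoothOn_shift c i j))
  · rw [(h4 i x hx).1, winding_one]
  · have e1 : shift c i i x = 0 := congrArg Prod.fst (c.g_self i x hx)
    have e2 : dualShift c' i i x = 0 := congrArg Prod.snd (c'.g_self i x hx)
    rw [(h4 i x hx).1, winding_one, realVec_zero, e1, e2, zero_dotProduct, zero_dotProduct,
      dotProduct_zero, neg_zero, add_zero, add_zero, expU_zero]
    exact mul_one 1
  · obtain ⟨⟨hi, hj⟩, hk⟩ := hx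
    refine phase_equivalence (shift_eq c hi hj hk) (dualShift_eq c hi hj hk) (h5 i j x ⟨hi, hj⟩)
      (h5 j k x ⟨hj, hk⟩) (dual_eq i j x ⟨hi, hj⟩) (dual_eq j k x ⟨hj, hk⟩)
      (dual_eq i k x ⟨hi, hk⟩) (hw i j k x ⟨⟨hi, hj⟩, hk⟩) ?_
    have e1 := (h6 i j k x ⟨⟨hi, hj⟩, hk⟩).1
    rw [fn_mapCocycle, fn_mapCocycle, eq_affine (h7 i j x ⟨hi, hj⟩), eq_affine (h7 j k x ⟨hj, hk⟩),
      eq_affine (h7 i k x ⟨hi, hk⟩), translate_affine, translate_affine, affine_mul, affine_mul,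
      affine_mul] at e1
    exact (affine_injective e1).1

end TDuality

theorem mainTheorem2 (n d : ℕ) (X : Type*) [TopologicalSpace X] [T2Space X]
    [SecondCountableTopology X] [ChartedSpace (EuclideanSpace ℝ (Fin d)) X]
    [IsManifold (𝓡 d) ∞ X] :
    Function.Bijective
      ((TDuality.leftLeg n).mapH1 :
        TDuality.H1 d X (TDuality.TD n) → TDuality.H1 d X (TDuality.TBF2R n)) := by
  constructor
  · rintro ⟨𝒰, c⟩ ⟨𝒰', c'⟩ H
    obtain ⟨𝒱, r, r', H⟩ := Quotient.exact H
    obtain ⟨ψ, hψ⟩ := TDuality.exists_partition (d := d) 𝒱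
    exact Quotient.sound ⟨𝒱, r, r', TDuality.TD.equivalent_of_mapCocycle hψ H⟩
  · rintro ⟨𝒰, c⟩
    obtain ⟨ψ, hψ⟩ := TDuality.exists_partition (d := d) 𝒰
    obtain ⟨c', hc', haff⟩ := TDuality.TBF2R.exists_equivalent_affine hψ c
    exact ⟨Quotient.mk _ ⟨𝒰, TDuality.TD.ofAffine hψ c' haff⟩, Quotient.sound
      ⟨𝒰, ⟨id, fun _ => le_rfl⟩, ⟨id, fun _ => le_rfl⟩,
        (TDuality.TD.mapCocycle_ofAffine_equivalent hψ c' haff).trans hc'⟩⟩
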